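/- For a finite partially ordered set $P$, let $\Delta(P)$ be its order complex: the simplicial complex whose vertices are the elements of $P$ and whose faces are the nonempty chains of $P$. If $P$ is a poset with at most $12$ elements, then the simplicial homology group $H_1(\Delta(P);\mathbb{Z})$ is torsion-free. Consequently, the smallest number of elements of a finite poset $P$ for which $H_1(\Delta(P);\mathbb{Z})$ has torsion is exactly $13$, and the smallest number of elements of a finite poset $P$ for which the geometric realization of $\Delta(P)$ is homotopy equivalent to the real projective plane $\mathbb{R}P^2$ is exactly $13$. -/

import Mathlib

open scoped ContinuousMap

universe u

/-! ### Simplicial homology with integer coefficients -/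

namespace AbstractSimplicialComplex

/-- The ordered `n`-simplices of a simplicial complex `K`: the tuples `(v₀, …, vₙ)` of vertices
(repetitions allowed) that all lie in a common face, i.e. whose underlying set is a face. -/
def OrderedSimplex {V : Type*} (K : AbstractSimplicialComplex V) (n : ℕ) : Type _ :=
  {v : Fin (n + 1) → V // ∃ s ∈ K.faces, ∀ i, v i ∈ s}

/-- The `i`-th face of an ordered simplex: omit the `i`-th vertex. -/
def OrderedSimplex.face {V : Type*} {K : AbstractSimplicialComplex V} {n : ℕ}
    (v : K.OrderedSimplex (n + 1)) (i : Fin (n + 2)) : K.OrderedSimplex n :=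
  ⟨fun j => v.1 (i.succAbove j), by
    obtain ⟨s, hs, h⟩ := v.2
    exact ⟨s, hs, fun j => h _⟩⟩

/-- The `n`-chains of `K` with integer coefficients (ordered chain complex of `K`): the free
abelian group on the ordered `n`-simplices. -/
abbrev Chains {V : Type*} (K : AbstractSimplicialComplex V) (n : ℕ) : Type _ :=
  K.OrderedSimplex n →₀ ℤ

/-- The boundary map `∂ (v₀, …, vₙ₊₁) = ∑ i, (-1) ^ i (v₀, …, v̂ᵢ, …, vₙ₊₁)`. -/
noncomputable def boundary {V : Type*} (K : AbstractSimplicialComplex V) (n : ℕ) :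
    K.Chains (n + 1) →ₗ[ℤ] K.Chains n :=
  Finsupp.linearCombination ℤ fun v : K.OrderedSimplex (n + 1) =>
    ∑ i : Fin (n + 2), (-1 : ℤ) ^ (i : ℕ) • Finsupp.single (v.face i) (1 : ℤ)

/-- The `n`-cycles: all `0`-chains for `n = 0`, the kernel of the boundary map otherwise. -/
noncomputable def cycles {V : Type*} (K : AbstractSimplicialComplex V) :
    (n : ℕ) → Submodule ℤ (K.Chains n)
  | 0 => ⊤
  | n + 1 => LinearMap.ker (K.boundary n)

/-- The `n`-boundaries. -/
noncomputable def boundaries {V : Type*} (K : AbstractSimplicialComplex V) (n : ℕ) :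
    Submodule ℤ (K.Chains n) :=
  LinearMap.range (K.boundary n)

/-- The homology group `H_n(K; ℤ)`, cycles modulo boundaries. -/
abbrev Homology {V : Type*} (K : AbstractSimplicialComplex V) (n : ℕ) : Type _ :=
  K.cycles n ⧸ (K.boundaries n).submoduleOf (K.cycles n)

/-- The geometric realization of a simplicial complex on a finite vertex set, in barycentric
coordinates: the points of the standard simplex whose support is a face, with the subspace
topology. -/
def realization {V : Type*} [Fintype V] (K : AbstractSimplicialComplex V) : Set (V → ℝ) :=
  {x | x ∈ stdSimplex ℝ V ∧ ∃ s ∈ K.faces, ∀ v, x v ≠ 0 → v ∈ s}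

end AbstractSimplicialComplex

/-- The order complex `Δ(P)` of a poset `P`: its vertices are the elements of `P` and its faces
are the nonempty finite chains of `P`. -/
def orderComplex (P : Type*) [PartialOrder P] : AbstractSimplicialComplex P where
  faces := {s | s.Nonempty ∧ IsChain (· ≤ ·) (s : Set P)}
  isRelLowerSet_faces := fun _ hs =>
    ⟨hs.1, fun _ hts ht => ⟨ht, hs.2.mono (Finset.coe_subset.mpr hts)⟩⟩
  singleton_mem := fun v => ⟨Finset.singleton_nonempty v, by
    rw [Finset.coe_singleton]
    exact Set.subsingleton_singleton.isChain⟩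

/-- The antipodal equivalence relation `x ∼ ±x` on the unit sphere of `ℝ³`. -/
def antipodalSetoid : Setoid (Metric.sphere (0 : EuclideanSpace ℝ (Fin 3)) 1) where
  r x y := x = y ∨ x = -y
  iseqv := by
    refine ⟨fun x => Or.inl rfl, ?_, ?_⟩
    · rintro x y (rfl | rfl)
      · exact Or.inl rfl
      · exact Or.inr (neg_neg y).symm
    · rintro x y z (rfl | rfl) (rfl | rfl)
      · exact Or.inl rfl
      · exact Or.inr rfl
      · exact Or.inr rfl
      · exact Or.inl (neg_neg z)

/-- The real projective plane: the unit sphere of `ℝ³` modulo the antipodal map, with the quotient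
topology. -/
abbrev RealProjectivePlane : Type := Quotient antipodalSetoid

/-! Torsion in `H₁` is an obstruction to lifting cocycles. Characters with values in `ℚ/ℤ` separate
the points of any abelian group, while a rational cocycle vanishes on every cycle a multiple of
which bounds. Hence `H₁` is torsion-free once all `ℚ/ℤ`-valued 1-cocycles lift to `ℚ`. On a poset
such a cocycle is a function on comparable pairs, additive along chains, and its values on pairs
starting at minimal elements determine it (`exists_lift_of_minimal`).

For at most twelve elements, isolated elements can be discarded. If then there are at least four
minimal and four maximal elements, at most four are left in the middle. The minimal and the maximal
elements give partial potentials on these four points, and the problem reduces to lifting cocycles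
on a complex with four vertices, which is always possible (`exists_lift_families`). Otherwise, up to
duality, there are at most three minimal elements. Lifting is then governed by a 3-partite
hypergraph: its vertices are the components of the sets `U i` of common upper bounds of two minimal
elements, its hyperedges the components of the set `W` of common upper bounds of all three. The lift
is found by stripping hyperedges unless a thick subhypergraph occurs, and that takes 3 minimal
elements, 4 elements of `W` and 2 elements of each `U i \ W`, thirteen in all.

Thirteen is attained by the faces of the octahedron modulo the antipodal map. Both the order complex
of this poset and the projective plane embed into the real 3 × 3 matrices with the same image.
Torsion is detected topologically, for every complex of this homotopy type: if `H₁` were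
torsion-free, the mod 2 cocycle of the pulled-back double covering would lift to an integral one,
which yields an odd map from the covering to the circle, hence an odd map from the 2-sphere to the
circle, contrary to Borsuk–Ulam. -/

namespace AbstractSimplicialComplex

/-! ### Torsion in first homology and lifting of cocycles -/

variable {V : Type*} (K : AbstractSimplicialComplex V)

/-- The value of the boundary on a generator. -/
theorem boundary_single (n : ℕ) (v : K.OrderedSimplex (n + 1)) :
    K.boundary n (Finsupp.single v 1) =
      ∑ i : Fin (n + 2), (-1 : ℤ) ^ (i : ℕ) • Finsupp.single (v.face i) (1 : ℤ) := by
  simp [boundary]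

theorem boundary_one_single (v : K.OrderedSimplex 2) :
    K.boundary 1 (Finsupp.single v 1) =
      Finsupp.single (v.face 0) 1 - Finsupp.single (v.face 1) 1 + Finsupp.single (v.face 2) 1 := by
  rw [boundary_single]
  simp [Fin.sum_univ_succ]
  abel

/-- A 1-cochain is a cocycle if it vanishes on boundaries of ordered 2-simplices. -/
def IsCocycle {G : Type*} [AddCommGroup G] (φ : K.OrderedSimplex 1 → G) : Prop :=
  ∀ v : K.OrderedSimplex 2, φ (v.face 0) - φ (v.face 1) + φ (v.face 2) = 0

variable {K}

theorem OrderedSimplex.ext_one {v w : K.OrderedSimplex 1} (h0 : v.1 0 = w.1 0)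
    (h1 : v.1 1 = w.1 1) : v = w := by
  apply Subtype.ext; funext j; fin_cases j <;> assumption

theorem IsCocycle.linearCombination_boundary {G : Type*} [AddCommGroup G]
    {φ : K.OrderedSimplex 1 → G} (hφ : K.IsCocycle φ) (z : K.Chains 2) :
    Finsupp.linearCombination ℤ φ (K.boundary 1 z) = 0 := by
  have : (Finsupp.linearCombination ℤ φ).comp (K.boundary 1) = 0 := by
    apply Finsupp.lhom_ext'
    intro v
    apply LinearMap.ext_ring
    simp only [LinearMap.comp_apply, Finsupp.lsingle_apply]
    rw [boundary_one_single]
    simpa using hφ v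
  exact LinearMap.congr_fun this z

theorem isCocycle_of_hom {G : Type*} [AddCommGroup G]
    (χ : (K.Chains 1 ⧸ K.boundaries 1) →ₗ[ℤ] G) :
    K.IsCocycle fun v => χ (Submodule.Quotient.mk (Finsupp.single v 1)) := by
  intro v
  dsimp only
  rw [← map_sub, ← map_add, ← Submodule.Quotient.mk_sub, ← Submodule.Quotient.mk_add,
    ← boundary_one_single, (Submodule.Quotient.mk_eq_zero (K.boundaries 1)).2
      (LinearMap.mem_range_self (K.boundary 1) _), map_zero]

/-- `H₁` is torsion-free as soon as every `ℚ/ℤ`-valued cocycle lifts to a rational one. -/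
theorem isAddTorsionFree_of_lift
    (h : ∀ φ : K.OrderedSimplex 1 → AddCircle (1 : ℚ), K.IsCocycle φ →
      ∃ ψ : K.OrderedSimplex 1 → ℚ, K.IsCocycle ψ ∧ ∀ v, (ψ v : AddCircle (1 : ℚ)) = φ v) :
    IsAddTorsionFree (K.Homology 1) := by
  refine ⟨fun n hn => ?_⟩
  suffices ∀ x : K.Homology 1, n • x = 0 → x = 0 by
    intro a b hab
    rw [← sub_eq_zero]
    apply this
    rw [nsmul_sub]
    exact sub_eq_zero.2 hab
  intro x hx
  induction x using Submodule.Quotient.induction_on with | _ z =>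
  rw [Submodule.Quotient.mk_eq_zero]
  rw [← Submodule.Quotient.mk_smul, Submodule.Quotient.mk_eq_zero] at hx
  change n • (z : K.Chains 1) ∈ K.boundaries 1 at hx
  change (z : K.Chains 1) ∈ K.boundaries 1
  rw [← Submodule.Quotient.mk_eq_zero]
  by_contra hne
  -- A character of `C₁/B₁` detecting the class of `z` is a `ℚ/ℤ`-valued cocycle. Its rational lift
  -- kills `n • z`, hence `z`, so the character kills `z` as well.
  obtain ⟨χ, hχ⟩ := CharacterModule.exists_character_apply_ne_zero_of_ne_zero hne
  obtain ⟨ψ, hψ, hψφ⟩ := h _ (isCocycle_of_hom (K := K) (AddMonoidHom.toIntLinearMap χ))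
  obtain ⟨w, hw⟩ := hx
  have h0 : Finsupp.linearCombination ℤ ψ (z : K.Chains 1) = 0 := by
    have := hψ.linearCombination_boundary w
    rw [hw, map_nsmul] at this
    exact (smul_eq_zero.1 this).resolve_left hn
  apply hχ
  have key : ((QuotientAddGroup.mk' (AddSubgroup.zmultiples (1 : ℚ))).toIntLinearMap).comp
      (Finsupp.linearCombination ℤ ψ) =
      (AddMonoidHom.toIntLinearMap χ).comp (Submodule.mkQ (K.boundaries 1)) := by
    apply Finsupp.lhom_ext'
    intro v
    apply LinearMap.ext_ring
    simpa using hψφ v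
  have := LinearMap.congr_fun key (z : K.Chains 1)
  simp only [LinearMap.comp_apply, h0, map_zero] at this
  exact this.symm

instance {V : Type*} [Finite V] (K : AbstractSimplicialComplex V) (n : ℕ) :
    Finite (K.OrderedSimplex n) := by
  unfold OrderedSimplex; infer_instance

theorem boundary_zero_comp_boundary_one : (K.boundary 0).comp (K.boundary 1) = 0 := by
  apply Finsupp.lhom_ext'
  intro v
  apply LinearMap.ext_ring
  simp only [LinearMap.comp_apply, Finsupp.lsingle_apply, LinearMap.zero_apply]
  rw [boundary_one_single, map_add, map_sub, boundary_single, boundary_single,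
    boundary_single]
  have h1 : (v.face 0).face 0 = (v.face 1).face 0 := by
    apply Subtype.ext; funext j; fin_cases j; rfl
  have h2 : (v.face 0).face 1 = (v.face 2).face 0 := by
    apply Subtype.ext; funext j; fin_cases j; rfl
  have h3 : (v.face 1).face 1 = (v.face 2).face 1 := by
    apply Subtype.ext; funext j; fin_cases j; rfl
  simp [Fin.sum_univ_succ, h1, h2, h3]
  abel

/-- If `H₁` is torsion-free, cocycles modulo 2 lift to integral cocycles. -/
theorem exists_int_lift [Finite V] (hK : IsAddTorsionFree (K.Homology 1))
    (φ : K.OrderedSimplex 1 → ZMod 2) (hφ : K.IsCocycle φ) :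
    ∃ ψ : K.OrderedSimplex 1 → ℤ, K.IsCocycle ψ ∧ ∀ v, (ψ v : ZMod 2) = φ v := by
  -- A chain with a nonzero multiple that bounds is itself a cycle, because the 0-chains are
  -- torsion-free. So `C₁/B₁` has no more torsion than `H₁`; being finitely generated, it is free,
  -- and maps out of it to `ZMod 2` lift to `ℤ`.
  have htf : IsAddTorsionFree (K.Chains 1 ⧸ K.boundaries 1) := by
    refine ⟨fun n hn => ?_⟩
    suffices ∀ x : K.Chains 1 ⧸ K.boundaries 1, n • x = 0 → x = 0 by
      intro a b hab
      rw [← sub_eq_zero]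
      apply this
      rw [nsmul_sub]
      exact sub_eq_zero.2 hab
    intro x hx
    induction x using Submodule.Quotient.induction_on with | _ z =>
    rw [← Submodule.Quotient.mk_smul, Submodule.Quotient.mk_eq_zero] at hx
    have hcyc : z ∈ K.cycles 1 := by
      obtain ⟨w, hw⟩ := hx
      have : K.boundary 0 (n • z) = 0 := by
        rw [← hw]
        exact LinearMap.congr_fun boundary_zero_comp_boundary_one w
      rw [map_nsmul] at this
      exact (smul_eq_zero.1 this).resolve_left hn
    have hx' : n • (Submodule.Quotient.mk ⟨z, hcyc⟩ : K.Homology 1) = 0 := by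
      rw [← Submodule.Quotient.mk_smul, Submodule.Quotient.mk_eq_zero]
      exact hx
    have := hK.nsmul_right_injective hn (hx'.trans (nsmul_zero n).symm)
    rw [Submodule.Quotient.mk_eq_zero] at this
    rw [Submodule.Quotient.mk_eq_zero]
    exact this
  have : Module.IsTorsionFree ℤ (K.Chains 1 ⧸ K.boundaries 1) := inferInstance
  have : Module.Finite ℤ (K.Chains 1 ⧸ K.boundaries 1) := inferInstance
  have : Module.Free ℤ (K.Chains 1 ⧸ K.boundaries 1) := inferInstance
  let χ : (K.Chains 1 ⧸ K.boundaries 1) →ₗ[ℤ] ZMod 2 :=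
    (K.boundaries 1).liftQ (Finsupp.linearCombination ℤ φ) (by
      rintro _ ⟨w, rfl⟩
      exact hφ.linearCombination_boundary w)
  obtain ⟨χ', hχ'⟩ := Module.projective_lifting_property
    (Int.castAddHom (ZMod 2)).toIntLinearMap χ (ZMod.intCast_surjective)
  refine ⟨_, isCocycle_of_hom χ', fun v => ?_⟩
  have := LinearMap.congr_fun hχ' (Submodule.Quotient.mk (Finsupp.single v 1))
  simp only [LinearMap.comp_apply] at this
  refine Eq.trans this ?_
  refine ((K.boundaries 1).liftQ_apply _ _).trans ?_
  simp

end AbstractSimplicialComplex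

/-! ### Cocycles on posets -/

/-- A function on pairs of comparable elements of a poset which is additive along chains. -/
def IsPosetCocycle {P G : Type*} [LE P] [Add G] (c : P → P → G) : Prop :=
  ∀ ⦃x y z⦄, x ≤ y → y ≤ z → c x y + c y z = c x z

/-- `d` lifts the poset cochain `c`. -/
def IsPosetLift {P : Type*} [LE P] (c : P → P → AddCircle (1 : ℚ)) (d : P → P → ℚ) : Prop :=
  ∀ ⦃x y⦄, x ≤ y → (d x y : AddCircle (1 : ℚ)) = c x y

/-- Every `ℚ/ℤ`-valued cocycle lifts to a rational one. -/
def CocyclesLift (P : Type*) [LE P] : Prop :=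
  ∀ c : P → P → AddCircle (1 : ℚ), IsPosetCocycle c →
    ∃ d : P → P → ℚ, IsPosetCocycle d ∧ IsPosetLift c d

theorem IsPosetCocycle.self {P G : Type*} [Preorder P] [AddCommGroup G] {c : P → P → G}
    (hc : IsPosetCocycle c) (x : P) : c x x = 0 := by
  simpa using hc (le_refl x) (le_refl x)

-- A cocycle on ordered simplices is determined by its values on increasing pairs, where it is a
-- poset cocycle; the lift found there is extended antisymmetrically.
open AbstractSimplicialComplex in
theorem CocyclesLift.isAddTorsionFree {P : Type*} [PartialOrder P] (h : CocyclesLift P) :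
    IsAddTorsionFree ((orderComplex P).Homology 1) := by
  classical
  apply AbstractSimplicialComplex.isAddTorsionFree_of_lift
  intro φ hφ
  let K := orderComplex P
  have tot : ∀ {n} (v : K.OrderedSimplex n) i j, v.1 i ≤ v.1 j ∨ v.1 j ≤ v.1 i := by
    intro n v i j
    obtain ⟨s, hs, hv⟩ := v.2
    exact hs.2.total (hv i) (hv j)
  have chain3 : ∀ {x y z : P}, x ≤ y → y ≤ z → ({x, y, z} : Finset P) ∈ K.faces := by
    intro x y z hxy hyz
    refine ⟨⟨x, by simp⟩, ?_⟩
    intro a ha b hb _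
    simp only [Finset.coe_insert, Finset.coe_singleton, Set.mem_insert_iff,
      Set.mem_singleton_iff] at ha hb
    have hxz := hxy.trans hyz
    rcases ha with rfl | rfl | rfl <;> rcases hb with rfl | rfl | rfl <;> simp [*]
  let e : ∀ x y : P, x ≤ y → K.OrderedSimplex 1 := fun x y hxy =>
    ⟨![x, y], _, chain3 hxy le_rfl, fun i => by fin_cases i <;> simp⟩
  let c : P → P → AddCircle (1 : ℚ) := fun x y => if hxy : x ≤ y then φ (e x y hxy) else 0
  have hc : IsPosetCocycle c := by
    intro x y z hxy hyz
    let t : K.OrderedSimplex 2 :=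
      ⟨![x, y, z], _, chain3 hxy hyz, fun i => by fin_cases i <;> simp⟩
    have := hφ t
    simp only [c, dif_pos hxy, dif_pos hyz, dif_pos (hxy.trans hyz)]
    rw [show e x y hxy = t.face 2 from OrderedSimplex.ext_one rfl rfl,
      show e y z hyz = t.face 0 from OrderedSimplex.ext_one rfl rfl,
      show e x z (hxy.trans hyz) = t.face 1 from OrderedSimplex.ext_one rfl rfl,
      ← sub_eq_zero, ← this]
    abel
  obtain ⟨d, hd, hdc⟩ := h c hc
  -- Since vertices may repeat, the triple `(x, x, x)` makes `φ` vanish on degenerate edges, and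
  -- then `(x, y, x)` makes it antisymmetric.
  have φself : ∀ v : K.OrderedSimplex 1, v.1 0 = v.1 1 → φ v = 0 := by
    intro v hv
    obtain ⟨s, hs, hvs⟩ := v.2
    let t : K.OrderedSimplex 2 := ⟨fun _ => v.1 0, s, hs, fun _ => hvs 0⟩
    have := hφ t
    rw [show t.face 0 = v from OrderedSimplex.ext_one rfl hv,
      show t.face 1 = v from OrderedSimplex.ext_one rfl hv,
      show t.face 2 = v from OrderedSimplex.ext_one rfl hv] at this
    simpa using this
  have φanti : ∀ v w : K.OrderedSimplex 1, v.1 0 = w.1 1 → v.1 1 = w.1 0 → φ v = - φ w := by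
    intro v w h0 h1
    obtain ⟨s, hs, hvs⟩ := v.2
    let t : K.OrderedSimplex 2 :=
      ⟨![v.1 0, v.1 1, v.1 0], s, hs, fun i => by fin_cases i <;> simp [hvs]⟩
    have := hφ t
    rw [show t.face 0 = w from OrderedSimplex.ext_one h1 h0, φself (t.face 1) rfl,
      show t.face 2 = v from OrderedSimplex.ext_one rfl rfl] at this
    rw [eq_neg_iff_add_eq_zero, add_comm]
    simpa using this
  let ψ : P → P → ℚ := fun x y => if x ≤ y then d x y else - d y x
  have ψ_le : ∀ {x y}, x ≤ y → ψ x y = d x y := fun h => if_pos h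
  have ψ_ge : ∀ {x y}, y ≤ x → ψ x y = - d y x := by
    intro x y hyx
    by_cases hxy : x ≤ y
    · obtain rfl := le_antisymm hxy hyx
      simp [ψ, hd.self]
    · exact if_neg hxy
  refine ⟨fun v => ψ (v.1 0) (v.1 1), ?_, ?_⟩
  · intro v
    change ψ (v.1 1) (v.1 2) - ψ (v.1 0) (v.1 2) + ψ (v.1 0) (v.1 1) = 0
    have h01 := tot v 0 1
    have h12 := tot v 1 2
    have h02 := tot v 0 2
    generalize v.1 0 = x at *
    generalize v.1 1 = y at *
    generalize v.1 2 = z at *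
    rcases h01 with h01 | h01 <;> rcases h12 with h12 | h12 <;> rcases h02 with h02 | h02 <;>
      simp only [ψ_le, ψ_ge, h01, h12, h02]
    · linarith [hd h01 h12]
    · obtain rfl := le_antisymm h12 (h02.trans h01)
      obtain rfl := le_antisymm h01 h02
      simp [hd.self]
    · linarith [hd h02 h12]
    · linarith [hd h02 h01]
    · linarith [hd h01 h02]
    · linarith [hd h12 h02]
    · obtain rfl := le_antisymm h12 (h01.trans h02)
      obtain rfl := le_antisymm h01 h02
      simp [hd.self]
    · linarith [hd h12 h01]
  · intro v
    rcases tot v 0 1 with h01 | h01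
    · simp only [ψ_le h01, hdc h01, c, dif_pos h01]
      rw [show e _ _ h01 = v from OrderedSimplex.ext_one rfl rfl]
    · simp only [ψ_ge h01, AddCircle.coe_neg, hdc h01, c, dif_pos h01]
      rw [φanti v (e _ _ h01) rfl rfl]

theorem AddCircle.exists_rat_coe (t : AddCircle (1 : ℚ)) : ∃ q : ℚ, (q : AddCircle (1 : ℚ)) = t :=
  QuotientAddGroup.mk_surjective t

/-- A lift of an element of `ℚ/ℤ` which may be prescribed if a condition holds. -/
theorem AddCircle.exists_rat_coe_of {p : Prop} {a : ℚ} {t : AddCircle (1 : ℚ)}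
    (h : p → (a : AddCircle (1 : ℚ)) = t) :
    ∃ q : ℚ, (q : AddCircle (1 : ℚ)) = t ∧ (p → q = a) := by
  by_cases hp : p
  · exact ⟨a, h hp, fun _ => rfl⟩
  · obtain ⟨q, hq⟩ := AddCircle.exists_rat_coe t
    exact ⟨q, hq, fun h => absurd h hp⟩

/-- It suffices to lift a cocycle on the pairs starting in a minimal element, compatibly. -/
theorem exists_lift_of_minimal {P : Type*} [PartialOrder P] [Finite P]
    {c : P → P → AddCircle (1 : ℚ)} (hc : IsPosetCocycle c) (a : P → P → ℚ)
    (ha : ∀ x z, IsMin x → x ≤ z → (a x z : AddCircle (1 : ℚ)) = c x z)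
    (hstar : ∀ x x' z z', IsMin x → IsMin x' → x ≤ z → x' ≤ z → z ≤ z' →
      a x z' - a x z = a x' z' - a x' z) :
    ∃ d : P → P → ℚ, IsPosetCocycle d ∧ IsPosetLift c d := by
  have hm : ∀ z : P, ∃ x, x ≤ z ∧ IsMin x := fun z => by
    obtain ⟨x, hxz, hx⟩ := (Set.toFinite (Set.univ : Set P)).exists_le_minimal (Set.mem_univ z)
    exact ⟨x, hxz, fun y hy => hx.2 (Set.mem_univ y) hy⟩
  choose m hmz hmin using hm
  -- Additivity forces this formula. By `hstar` the difference does not depend on the minimal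
  -- element chosen below `z`.
  refine ⟨fun z z' => a (m z) z' - a (m z) z, fun x y z hxy hyz => ?_, fun x y hxy => ?_⟩
  · have := hstar (m y) (m x) y z (hmin y) (hmin x) (hmz y) ((hmz x).trans hxy) hyz
    dsimp only
    linarith
  · rw [AddCircle.coe_sub, ha _ _ (hmin x) ((hmz x).trans hxy), ha _ _ (hmin x) (hmz x),
      ← hc (hmz x) hxy]
    abel

/-! ### Potentials on four points and posets with at most four middle elements -/

section Simplex

/-- Extending prescribed lifts of differences to a lift of a function on three points. -/
theorem exists_lift_triple {φ₀ φ₁ φ₂ : AddCircle (1 : ℚ)} {l₀₁ l₁₂ l₀₂ : Prop} {e₀₁ e₁₂ e₀₂ : ℚ}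
    (h₀₁ : l₀₁ → (e₀₁ : AddCircle (1 : ℚ)) = φ₀ - φ₁)
    (h₁₂ : l₁₂ → (e₁₂ : AddCircle (1 : ℚ)) = φ₁ - φ₂)
    (h₀₂ : l₀₂ → (e₀₂ : AddCircle (1 : ℚ)) = φ₀ - φ₂)
    (h : l₀₁ → l₁₂ → l₀₂ → e₀₁ + e₁₂ = e₀₂) :
    ∃ ψ₀ ψ₁ ψ₂ : ℚ, (ψ₀ : AddCircle (1 : ℚ)) = φ₀ ∧ (ψ₁ : AddCircle (1 : ℚ)) = φ₁ ∧
      (ψ₂ : AddCircle (1 : ℚ)) = φ₂ ∧ (l₀₁ → ψ₀ - ψ₁ = e₀₁) ∧ (l₁₂ → ψ₁ - ψ₂ = e₁₂) ∧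
      (l₀₂ → ψ₀ - ψ₂ = e₀₂) := by
  obtain ⟨ψ₁, k₁⟩ := AddCircle.exists_rat_coe φ₁
  -- Values are propagated from `ψ₁` along the prescribed edges. These form a forest, and impose no
  -- condition on each other, unless all three occur; only then is `h` needed.
  by_cases l : l₁₂
  · by_cases l' : l₀₁
    · refine ⟨ψ₁ + e₀₁, ψ₁, ψ₁ - e₁₂, ?_, k₁, ?_, ?_, ?_, ?_⟩
      · rw [AddCircle.coe_add, k₁, h₀₁ l']; abel
      · rw [AddCircle.coe_sub, k₁, h₁₂ l]; abel
      · intro; ring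
      · intro; ring
      · intro h02; rw [← h l' l h02]; ring
    · obtain ⟨ψ₀, k₀, k₀'⟩ := AddCircle.exists_rat_coe_of (p := l₀₂) (a := ψ₁ - e₁₂ + e₀₂)
        (t := φ₀) (fun h02 => by
          rw [AddCircle.coe_add, AddCircle.coe_sub, k₁, h₁₂ l, h₀₂ h02]; abel)
      refine ⟨ψ₀, ψ₁, ψ₁ - e₁₂, k₀, k₁, ?_, fun h => absurd h l', ?_, ?_⟩
      · rw [AddCircle.coe_sub, k₁, h₁₂ l]; abel
      · intro; ring
      · intro h02; rw [k₀' h02]; ring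
  · obtain ⟨ψ₀, k₀, k₀'⟩ := AddCircle.exists_rat_coe_of (p := l₀₁) (a := ψ₁ + e₀₁)
      (t := φ₀) (fun h01 => by rw [AddCircle.coe_add, k₁, h₀₁ h01]; abel)
    obtain ⟨ψ₂, k₂, k₂'⟩ := AddCircle.exists_rat_coe_of (p := l₀₂) (a := ψ₀ - e₀₂)
      (t := φ₂) (fun h02 => by rw [AddCircle.coe_sub, k₀, h₀₂ h02]; abel)
    refine ⟨ψ₀, ψ₁, ψ₂, k₀, k₁, k₂, ?_, fun h => absurd h l, ?_⟩
    · intro h01; rw [k₀' h01]; ring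
    · intro h02; rw [k₂' h02]; ring

/-- Cocycles lift on every simplicial complex with four vertices. -/
theorem exists_lift_tetrahedron (d : Fin 4 → Fin 4 → AddCircle (1 : ℚ))
    (t : Fin 4 → Fin 4 → Fin 4 → Prop)
    (h : ∀ i j k, i < j → j < k → t i j k → d i j + d j k = d i k) :
    ∃ e : Fin 4 → Fin 4 → ℚ, (∀ i j, i < j → (e i j : AddCircle (1 : ℚ)) = d i j) ∧
      ∀ i j k, i < j → j < k → t i j k → e i j + e j k = e i k := by
  suffices ∃ e₀₁ e₀₂ e₀₃ e₁₂ e₁₃ e₂₃ : ℚ, (e₀₁ : AddCircle (1 : ℚ)) = d 0 1 ∧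
      (e₀₂ : AddCircle (1 : ℚ)) = d 0 2 ∧ (e₀₃ : AddCircle (1 : ℚ)) = d 0 3 ∧
      (e₁₂ : AddCircle (1 : ℚ)) = d 1 2 ∧ (e₁₃ : AddCircle (1 : ℚ)) = d 1 3 ∧
      (e₂₃ : AddCircle (1 : ℚ)) = d 2 3 ∧ (t 0 1 2 → e₀₁ + e₁₂ = e₀₂) ∧
      (t 0 1 3 → e₀₁ + e₁₃ = e₀₃) ∧ (t 0 2 3 → e₀₂ + e₂₃ = e₀₃) ∧
      (t 1 2 3 → e₁₂ + e₂₃ = e₁₃) by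
    obtain ⟨e₀₁, e₀₂, e₀₃, e₁₂, e₁₃, e₂₃, h₀₁, h₀₂, h₀₃, h₁₂, h₁₃, h₂₃, t₀, t₁, t₂, t₃⟩ := this
    refine ⟨![![0, e₀₁, e₀₂, e₀₃], ![0, 0, e₁₂, e₁₃], ![0, 0, 0, e₂₃], ![0, 0, 0, 0]], ?_, ?_⟩
    · intro i j hij
      fin_cases i <;> fin_cases j <;> first | exact absurd hij (by decide) | assumption
    · intro i j k hij hjk
      fin_cases i <;> fin_cases j <;> first | exact absurd hij (by decide) | skip
      all_goals fin_cases k <;> first | exact absurd hjk (by decide) | assumption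
  have r₀ := h 0 1 2 (by decide) (by decide)
  have r₁ := h 0 1 3 (by decide) (by decide)
  have r₂ := h 0 2 3 (by decide) (by decide)
  have r₃ := h 1 2 3 (by decide) (by decide)
  obtain ⟨e₀₃, k₀₃⟩ := AddCircle.exists_rat_coe (d 0 3)
  obtain ⟨e₁₃, k₁₃⟩ := AddCircle.exists_rat_coe (d 1 3)
  obtain ⟨e₂₃, k₂₃⟩ := AddCircle.exists_rat_coe (d 2 3)
  have c₀₁ : t 0 1 3 → ((e₀₃ - e₁₃ : ℚ) : AddCircle (1 : ℚ)) = d 0 1 := fun ht => by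
    rw [AddCircle.coe_sub, k₀₃, k₁₃, ← r₁ ht]; abel
  have c₀₂ : t 0 2 3 → ((e₀₃ - e₂₃ : ℚ) : AddCircle (1 : ℚ)) = d 0 2 := fun ht => by
    rw [AddCircle.coe_sub, k₀₃, k₂₃, ← r₂ ht]; abel
  have c₁₂ : t 1 2 3 → ((e₁₃ - e₂₃ : ℚ) : AddCircle (1 : ℚ)) = d 1 2 := fun ht => by
    rw [AddCircle.coe_sub, k₁₃, k₂₃, ← r₃ ht]; abel
  obtain ⟨e₀₁, k₀₁, k₀₁'⟩ := AddCircle.exists_rat_coe_of c₀₁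
  obtain ⟨e₀₂, k₀₂, k₀₂'⟩ := AddCircle.exists_rat_coe_of c₀₂
  obtain ⟨e₁₂, k₁₂, k₁₂'⟩ := AddCircle.exists_rat_coe_of c₁₂
  -- If all three triangles at vertex 3 are present, the edges opposite to it are differences of the
  -- edges into 3, and the triangle `0 1 2` closes automatically. If one of them is missing, its
  -- edge opposite to 3 lies in no other triangle than `0 1 2` and can be chosen last to close it.
  by_cases h₁ : t 0 1 3
  · by_cases h₂ : t 0 2 3
    · by_cases h₃ : t 1 2 3
      · refine ⟨e₀₁, e₀₂, e₀₃, e₁₂, e₁₃, e₂₃, k₀₁, k₀₂, k₀₃, k₁₂, k₁₃, k₂₃, ?_, ?_, ?_, ?_⟩ <;>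
          intro <;> simp only [k₀₁' h₁, k₀₂' h₂, k₁₂' h₃] <;> ring
      · obtain ⟨e₁₂, k₁₂, k₁₂'⟩ := AddCircle.exists_rat_coe_of (p := t 0 1 2) (a := e₀₂ - e₀₁)
          (t := d 1 2) (fun ht => by rw [AddCircle.coe_sub, k₀₁, k₀₂, ← r₀ ht]; abel)
        refine ⟨e₀₁, e₀₂, e₀₃, e₁₂, e₁₃, e₂₃, k₀₁, k₀₂, k₀₃, k₁₂, k₁₃, k₂₃, ?_, ?_, ?_,
          fun h => absurd h h₃⟩
        · intro h; rw [k₁₂' h]; ring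
        · intro h; rw [k₀₁' h]; ring
        · intro h; rw [k₀₂' h]; ring
    · obtain ⟨e₀₂, k₀₂, k₀₂'⟩ := AddCircle.exists_rat_coe_of (p := t 0 1 2) (a := e₀₁ + e₁₂)
        (t := d 0 2) (fun ht => by rw [AddCircle.coe_add, k₀₁, k₁₂, ← r₀ ht])
      refine ⟨e₀₁, e₀₂, e₀₃, e₁₂, e₁₃, e₂₃, k₀₁, k₀₂, k₀₃, k₁₂, k₁₃, k₂₃, ?_, ?_,
        fun h => absurd h h₂, ?_⟩
      · intro h; rw [k₀₂' h]
      · intro h; rw [k₀₁' h]; ring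
      · intro h; rw [k₁₂' h]; ring
  · obtain ⟨e₀₁, k₀₁, k₀₁'⟩ := AddCircle.exists_rat_coe_of (p := t 0 1 2) (a := e₀₂ - e₁₂)
      (t := d 0 1) (fun ht => by rw [AddCircle.coe_sub, k₀₂, k₁₂, ← r₀ ht]; abel)
    refine ⟨e₀₁, e₀₂, e₀₃, e₁₂, e₁₃, e₂₃, k₀₁, k₀₂, k₀₃, k₁₂, k₁₃, k₂₃, ?_,
      fun h => absurd h h₁, ?_, ?_⟩
    · intro h; rw [k₀₁' h]; ring
    · intro h; rw [k₀₂' h]; ring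
    · intro h; rw [k₁₂' h]; ring

/-- Extending prescribed lifts of differences to a lift of a function on a proper subset of
four points. -/
theorem exists_lift_proper {φ : Fin 4 → AddCircle (1 : ℚ)} {A : Fin 4 → Prop}
    {l : Fin 4 → Fin 4 → Prop} {e : Fin 4 → Fin 4 → ℚ}
    (he : ∀ i j, i < j → l i j → A i → A j → (e i j : AddCircle (1 : ℚ)) = φ i - φ j)
    (ht : ∀ i j k, i < j → j < k → l i j → l j k → l i k → A i → A j → A k →
      e i j + e j k = e i k) (hA : ∃ i, ¬ A i) :
    ∃ ψ : Fin 4 → ℚ, (∀ i, (ψ i : AddCircle (1 : ℚ)) = φ i) ∧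
      ∀ i j, i < j → l i j → A i → A j → ψ i - ψ j = e i j := by
  have key : ∀ i j k : Fin 4, i < j → j < k → ∃ ψ₀ ψ₁ ψ₂ : ℚ, (ψ₀ : AddCircle (1 : ℚ)) = φ i ∧
      (ψ₁ : AddCircle (1 : ℚ)) = φ j ∧ (ψ₂ : AddCircle (1 : ℚ)) = φ k ∧
      (l i j → A i → A j → ψ₀ - ψ₁ = e i j) ∧ (l j k → A j → A k → ψ₁ - ψ₂ = e j k) ∧
      (l i k → A i → A k → ψ₀ - ψ₂ = e i k) := by
    intro i j k hij hjk
    obtain ⟨ψ₀, ψ₁, ψ₂, h₀, h₁, h₂, h₀₁, h₁₂, h₀₂⟩ := exists_lift_triple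
      (l₀₁ := l i j ∧ A i ∧ A j) (l₁₂ := l j k ∧ A j ∧ A k) (l₀₂ := l i k ∧ A i ∧ A k)
      (fun h => he i j hij h.1 h.2.1 h.2.2) (fun h => he j k hjk h.1 h.2.1 h.2.2)
      (fun h => he i k (hij.trans hjk) h.1 h.2.1 h.2.2)
      (fun h h' h'' => ht i j k hij hjk h.1 h'.1 h''.1 h.2.1 h.2.2 h'.2.2)
    exact ⟨ψ₀, ψ₁, ψ₂, h₀, h₁, h₂, fun a b c => h₀₁ ⟨a, b, c⟩, fun a b c => h₁₂ ⟨a, b, c⟩,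
      fun a b c => h₀₂ ⟨a, b, c⟩⟩
  obtain ⟨i, hi⟩ := hA
  -- No condition involves the missing point, so any lift serves there; the other three points are
  -- covered by `exists_lift_triple`.
  obtain ⟨χ, hχ⟩ := AddCircle.exists_rat_coe (φ i)
  fin_cases i
  · obtain ⟨a, b, c, h₀, h₁, h₂, k₀, k₁, k₂⟩ := key 1 2 3 (by decide) (by decide)
    refine ⟨![χ, a, b, c], fun i => by fin_cases i <;> assumption, fun i j hij => ?_⟩
    fin_cases i <;> fin_cases j <;>
      first | exact absurd hij (by decide) | assumption |
        exact fun _ h _ => absurd h hi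
  · obtain ⟨a, b, c, h₀, h₁, h₂, k₀, k₁, k₂⟩ := key 0 2 3 (by decide) (by decide)
    refine ⟨![a, χ, b, c], fun i => by fin_cases i <;> assumption, fun i j hij => ?_⟩
    fin_cases i <;> fin_cases j <;>
      first | exact absurd hij (by decide) | assumption |
        exact fun _ h _ => absurd h hi | exact fun _ _ h => absurd h hi
  · obtain ⟨a, b, c, h₀, h₁, h₂, k₀, k₁, k₂⟩ := key 0 1 3 (by decide) (by decide)
    refine ⟨![a, b, χ, c], fun i => by fin_cases i <;> assumption, fun i j hij => ?_⟩
    fin_cases i <;> fin_cases j <;>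
      first | exact absurd hij (by decide) | assumption |
        exact fun _ h _ => absurd h hi | exact fun _ _ h => absurd h hi
  · obtain ⟨a, b, c, h₀, h₁, h₂, k₀, k₁, k₂⟩ := key 0 1 2 (by decide) (by decide)
    refine ⟨![a, b, c, χ], fun i => by fin_cases i <;> assumption, fun i j hij => ?_⟩
    fin_cases i <;> fin_cases j <;>
      first | exact absurd hij (by decide) | assumption |
        exact fun _ h _ => absurd h hi | exact fun _ _ h => absurd h hi

variable {X Y : Type*} {R : X → Fin 4 → Prop} {S : Y → Fin 4 → Prop}
  {f : X → Fin 4 → AddCircle (1 : ℚ)} {g : Y → Fin 4 → AddCircle (1 : ℚ)}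

/-- Simultaneous lifting of two families of partial potentials, if one member of the first family
is defined everywhere. -/
theorem exists_lift_families_of_full
    (h : ∀ x y i j, R x i → R x j → S y i → S y j → f x i - f x j = g y i - g y j)
    {x₀ : X} (hx₀ : ∀ i, R x₀ i) :
    ∃ (f' : X → Fin 4 → ℚ) (g' : Y → Fin 4 → ℚ),
      (∀ x i, (f' x i : AddCircle (1 : ℚ)) = f x i) ∧
      (∀ y i, (g' y i : AddCircle (1 : ℚ)) = g y i) ∧
      ∀ x y i j, R x i → R x j → S y i → S y j → f' x i - f' x j = g' y i - g' y j := by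
  choose s hs using AddCircle.exists_rat_coe
  -- The everywhere defined `f x₀` serves as a global potential. Relative to it, the remaining
  -- potentials take equal values at any two indices to be compared, and the section `s` lifts equal
  -- values equally, although it is not additive.
  refine ⟨fun x i => s (f x₀ i) + s (f x i - f x₀ i), fun y i => s (f x₀ i) + s (g y i - f x₀ i),
    fun x i => ?_, fun y i => ?_, fun x y i j hxi hxj hyi hyj => ?_⟩
  · rw [AddCircle.coe_add, hs, hs]; abel
  · rw [AddCircle.coe_add, hs, hs]; abel
  · have h1 := h x y i j hxi hxj hyi hyj
    have h2 := h x₀ y i j (hx₀ i) (hx₀ j) hyi hyj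
    have e1 : f x i - f x₀ i = f x j - f x₀ j := by
      rw [sub_eq_sub_iff_sub_eq_sub, h1, h2]
    have e2 : g y i - f x₀ i = g y j - f x₀ j := by
      rw [sub_eq_sub_iff_sub_eq_sub, h2]
    dsimp only
    rw [e1, e2]; ring

/-- Simultaneous lifting of two families of partial potentials on four points. -/
theorem exists_lift_families
    (h : ∀ x y i j, R x i → R x j → S y i → S y j → f x i - f x j = g y i - g y j) :
    ∃ (f' : X → Fin 4 → ℚ) (g' : Y → Fin 4 → ℚ),
      (∀ x i, (f' x i : AddCircle (1 : ℚ)) = f x i) ∧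
      (∀ y i, (g' y i : AddCircle (1 : ℚ)) = g y i) ∧
      ∀ x y i j, R x i → R x j → S y i → S y j → f' x i - f' x j = g' y i - g' y j := by
  classical
  by_cases hR : ∃ x, ∀ i, R x i
  · obtain ⟨x₀, hx₀⟩ := hR
    exact exists_lift_families_of_full h hx₀
  by_cases hS : ∃ y, ∀ i, S y i
  · obtain ⟨y₀, hy₀⟩ := hS
    obtain ⟨g', f', hg, hf, hgf⟩ := exists_lift_families_of_full (R := S) (S := R) (f := g) (g := f)
      (fun y x i j a b c d => (h x y i j c d a b).symm) hy₀
    exact ⟨f', g', hf, hg, fun x y i j a b c d => (hgf y x i j c d a b).symm⟩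
  push Not at hR hS
  -- Only pairs seen by both families are constrained, and on them `h` makes the difference common
  -- to all members. The triangles to be respected are those seen by a single member. As no member
  -- is defined on all four points, prescribed differences extend to each one separately.
  let L : Fin 4 → Fin 4 → Prop := fun i j => (∃ x, R x i ∧ R x j) ∧ ∃ y, S y i ∧ S y j
  have hd : ∀ i j, ∃ d, L i j → (∀ x, R x i → R x j → f x i - f x j = d) ∧
      ∀ y, S y i → S y j → g y i - g y j = d := by
    intro i j
    by_cases hL : L i j
    · obtain ⟨⟨x, hxi, hxj⟩, y, hyi, hyj⟩ := hL
      refine ⟨f x i - f x j, fun _ => ⟨fun x' h1 h2 => ?_, fun y' h1 h2 => ?_⟩⟩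
      · rw [h x y i j hxi hxj hyi hyj, h x' y i j h1 h2 hyi hyj]
      · rw [h x y' i j hxi hxj h1 h2]
    · exact ⟨0, fun h => absurd h hL⟩
  choose d hd using hd
  obtain ⟨e, hed, het⟩ := exists_lift_tetrahedron d
    (fun i j k => L i j ∧ L j k ∧ L i k ∧
      ((∃ x, R x i ∧ R x j ∧ R x k) ∨ ∃ y, S y i ∧ S y j ∧ S y k)) (by
    rintro i j k - - ⟨lij, ljk, lik, ⟨x, hi, hj, hk⟩ | ⟨y, hi, hj, hk⟩⟩
    · rw [← (hd i j lij).1 x hi hj, ← (hd j k ljk).1 x hj hk, ← (hd i k lik).1 x hi hk]; abel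
    · rw [← (hd i j lij).2 y hi hj, ← (hd j k ljk).2 y hj hk, ← (hd i k lik).2 y hi hk]; abel)
  have hf : ∀ x, ∃ ψ : Fin 4 → ℚ, (∀ i, (ψ i : AddCircle (1 : ℚ)) = f x i) ∧
      ∀ i j, i < j → L i j → R x i → R x j → ψ i - ψ j = e i j := fun x =>
    exists_lift_proper
      (fun i j hij l hi hj => by rw [hed i j hij, (hd i j l).1 x hi hj])
      (fun i j k hij hjk l l' l'' hi hj hk =>
        het i j k hij hjk ⟨l, l', l'', Or.inl ⟨x, hi, hj, hk⟩⟩) (hR x)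
  have hg : ∀ y, ∃ ψ : Fin 4 → ℚ, (∀ i, (ψ i : AddCircle (1 : ℚ)) = g y i) ∧
      ∀ i j, i < j → L i j → S y i → S y j → ψ i - ψ j = e i j := fun y =>
    exists_lift_proper
      (fun i j hij l hi hj => by rw [hed i j hij, (hd i j l).2 y hi hj])
      (fun i j k hij hjk l l' l'' hi hj hk =>
        het i j k hij hjk ⟨l, l', l'', Or.inr ⟨y, hi, hj, hk⟩⟩) (hS y)
  choose f' hf1 hf2 using hf
  choose g' hg1 hg2 using hg
  refine ⟨f', g', hf1, hg1, fun x y i j hxi hxj hyi hyj => ?_⟩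
  rcases lt_trichotomy i j with hij | rfl | hij
  · have l : L i j := ⟨⟨x, hxi, hxj⟩, y, hyi, hyj⟩
    rw [hf2 x i j hij l hxi hxj, hg2 y i j hij l hyi hyj]
  · simp
  · have l : L j i := ⟨⟨x, hxj, hxi⟩, y, hyj, hyi⟩
    rw [← neg_sub, hf2 x j i hij l hxj hxi, ← hg2 y j i hij l hyj hyi, neg_sub]

end Simplex

/-- Cocycles lift on a poset in which at most four elements are neither minimal nor maximal. -/
theorem cocyclesLift_of_card_middle_le {P : Type*} [PartialOrder P] [Finite P]
    (hP : Nat.card {q : P // ¬ IsMin q ∧ ¬ IsMax q} ≤ 4) : CocyclesLift P := by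
  classical
  intro c hc
  let Q := {q : P // ¬ IsMin q ∧ ¬ IsMax q}
  obtain ⟨e⟩ : Nonempty (Q ↪ Fin 4) := by
    have := Fintype.ofFinite Q
    rw [Nat.card_eq_fintype_card] at hP
    exact Function.Embedding.nonempty_of_card_le (by simpa using hP)
  -- The middle elements are padded to four indices; unused ones carry `none` and satisfy no
  -- relation.
  obtain ⟨p, hp⟩ : ∃ p : Fin 4 → Option Q, ∀ i q, p i = some q ↔ e q = i := by
    refine ⟨fun i => if h : ∃ q, e q = i then some h.choose else none, fun i q => ?_⟩
    by_cases h : ∃ q, e q = i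
    · simp only [dif_pos h, Option.some.injEq]
      constructor
      · rintro rfl; exact h.choose_spec
      · intro h'; exact e.injective (h.choose_spec.trans h'.symm)
    · simp only [dif_neg h]
      constructor
      · intro h'; cases h'
      · intro h'; exact absurd ⟨q, h'⟩ h
  have hpe : ∀ q, p (e q) = some q := fun q => (hp _ _).2 rfl
  -- For `x ≤ q, r ≤ y`, both `c x q + c q y` and `c x r + c r y` equal `c x y`. With the sign in
  -- `g`, this is the compatibility of the two families.
  obtain ⟨f, g, hf, hg, hfg⟩ := exists_lift_families (X := P) (Y := P)
    (R := fun x i => ∃ q, p i = some q ∧ IsMin x ∧ x ≤ q)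
    (S := fun y i => ∃ q, p i = some q ∧ IsMax y ∧ (q : P) ≤ y)
    (f := fun x i => (p i).elim 0 fun q => c x q)
    (g := fun y i => (p i).elim 0 fun q => - c q y) (by
      rintro x y i j ⟨q, hq, hx, hxq⟩ ⟨r, hr, -, hxr⟩ ⟨q', hq', hy, hyq⟩ ⟨r', hr', -, hyr⟩
      obtain rfl : q = q' := by rw [hq] at hq'; exact Option.some.inj hq'
      obtain rfl : r = r' := by rw [hr] at hr'; exact Option.some.inj hr'
      simp only [hq, hr, Option.elim_some]
      have h1 := hc hxq hyq
      have h2 := hc hxr hyr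
      rw [sub_eq_sub_iff_add_eq_add, eq_sub_of_add_eq h1, eq_sub_of_add_eq h2]
      abel)
  replace hf : ∀ x q, (f x (e q) : AddCircle (1 : ℚ)) = c x q := fun x q => by
    rw [hf, hpe]; rfl
  replace hg : ∀ y q, (g y (e q) : AddCircle (1 : ℚ)) = - c q y := fun y q => by
    rw [hg, hpe]; rfl
  replace hfg : ∀ (x y : P) (q r : Q), IsMin x → IsMax y → x ≤ q → x ≤ r → (q : P) ≤ y → (r : P) ≤ y →
      f x (e q) - f x (e r) = g y (e q) - g y (e r) := fun x y q r hx hy h1 h2 h3 h4 =>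
    hfg x y _ _ ⟨q, hpe q, hx, h1⟩ ⟨r, hpe r, hx, h2⟩ ⟨q, hpe q, hy, h3⟩ ⟨r, hpe r, hy, h4⟩
  obtain ⟨s, hs⟩ : ∃ s : AddCircle (1 : ℚ) → ℚ, ∀ t, (s t : AddCircle (1 : ℚ)) = t :=
    ⟨_, fun t => (AddCircle.exists_rat_coe t).choose_spec⟩
  -- For maximal `z`, the value must factor through any middle element between `x` and `z`; by `hfg`
  -- all of these give the same result. With none in between, any lift will do.
  let a : P → P → ℚ := fun x z => if hz : ¬ IsMin z ∧ ¬ IsMax z then f x (e ⟨z, hz⟩)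
    else if x = z then 0
    else if h : ∃ q : Q, x ≤ q ∧ (q : P) ≤ z then f x (e h.choose) - g z (e h.choose)
    else s (c x z)
  have a_mid : ∀ x (q : Q), a x q = f x (e q) := fun x q => dif_pos q.2
  have a_max : ∀ (x z : P) (q : Q), IsMin x → IsMax z → x ≤ q → (q : P) ≤ z →
      a x z = f x (e q) - g z (e q) := by
    intro x z q hx hz hxq hqz
    have hne : x ≠ z := by
      rintro rfl
      obtain rfl : x = q := le_antisymm hxq hqz
      exact q.2.2 hz
    have hex : ∃ q : Q, x ≤ q ∧ (q : P) ≤ z := ⟨q, hxq, hqz⟩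
    have : a x z = f x (e hex.choose) - g z (e hex.choose) := by
      simp only [a]
      rw [dif_neg (fun h => h.2 hz), if_neg hne, dif_pos hex]
    rw [this]
    have := hfg x z hex.choose q hx hz hex.choose_spec.1 hxq hex.choose_spec.2 hqz
    linarith
  apply exists_lift_of_minimal hc a
  · intro x z hx hxz
    simp only [a]
    split_ifs with h1 h2 h3
    · rw [hf]
    · subst h2; rw [hc.self]; rfl
    · rw [AddCircle.coe_sub, hf, hg, ← hc h3.choose_spec.1 h3.choose_spec.2, sub_neg_eq_add]
    · exact hs _
  · intro x x' z z' hx hx' hxz hxz' hzz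
    rcases hzz.eq_or_lt with rfl | hlt
    · simp
    by_cases hzmin : IsMin z
    · rw [show x = x' from (hzmin.eq_of_ge hxz).symm.trans (hzmin.eq_of_ge hxz')]
    have hz : ¬ IsMin z ∧ ¬ IsMax z := ⟨hzmin, hlt.not_isMax⟩
    by_cases hz' : IsMax z'
    · have h1 := a_max x z' ⟨z, hz⟩ hx hz' hxz hzz
      have h2 := a_max x' z' ⟨z, hz⟩ hx' hz' hxz' hzz
      have h3 := a_mid x ⟨z, hz⟩
      have h4 := a_mid x' ⟨z, hz⟩
      simp only at h3 h4
      rw [h1, h2, h3, h4]; ring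
    · have hz'' : ¬ IsMin z' ∧ ¬ IsMax z' := ⟨hlt.not_isMin, hz'⟩
      -- A maximal element above `z'` compares the differences for `x` and `x'`: both equal the
      -- difference for `y`.
      obtain ⟨y, hzy, hy⟩ :=
        (Set.toFinite (Set.univ : Set P)).exists_le_maximal (Set.mem_univ z')
      have hy : IsMax y := fun w hw => hy.2 (Set.mem_univ w) hw
      have h1 := hfg x y ⟨z', hz''⟩ ⟨z, hz⟩ hx hy (hxz.trans hzz) hxz hzy (hzz.trans hzy)
      have h2 := hfg x' y ⟨z', hz''⟩ ⟨z, hz⟩ hx' hy (hxz'.trans hzz) hxz' hzy (hzz.trans hzy)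
      have e1 := a_mid x ⟨z, hz⟩
      have e2 := a_mid x' ⟨z, hz⟩
      have e3 := a_mid x ⟨z', hz''⟩
      have e4 := a_mid x' ⟨z', hz''⟩
      simp only at e1 e2 e3 e4
      rw [e1, e2, e3, e4, h1, h2]

/-! ### Three-partite hypergraphs and posets with at most three minimal elements -/

section Hypergraph

variable {τ : Type*} {E : Fin 3 → Type*} (e : ∀ i, τ → E i)

/-- A set of hyperedges of a 3-partite hypergraph in which every part has at least two vertices
that are in use, and each of these is in at least two hyperedges. -/
def IsThick (σ : Finset τ) : Prop :=
  ∀ i, (∀ t ∈ σ, ∃ t' ∈ σ, t' ≠ t ∧ e i t' = e i t) ∧ ∃ t ∈ σ, ∃ t' ∈ σ, e i t ≠ e i t'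

/-- A cocycle on a 3-partite hypergraph without thick sets of hyperedges lifts. -/
theorem exists_lift_of_forall_not_isThick (d : ∀ i, E i → AddCircle (1 : ℚ)) (σ : Finset τ)
    (h : ∀ t ∈ σ, ∑ i, d i (e i t) = 0) (hσ : ∀ σ' ⊆ σ, ¬ IsThick e σ') :
    ∃ d' : ∀ i, E i → ℚ, (∀ i w, (d' i w : AddCircle (1 : ℚ)) = d i w) ∧
      ∀ t ∈ σ, ∑ i, d' i (e i t) = 0 := by
  classical
  choose s hs using AddCircle.exists_rat_coe
  induction σ using Finset.strongInduction with | _ σ ih =>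
  have hthick := hσ σ subset_rfl
  simp only [IsThick, not_forall, not_and_or] at hthick
  obtain ⟨i, ⟨t, ht, hti⟩ | hi⟩ := hthick
  -- The vertex `e i t` lies in no hyperedge of `σ` other than `t`. After lifting on the rest, the
  -- defect `S` at `t`, which is zero in `ℚ/ℤ`, is subtracted at this vertex without harm elsewhere.
  · push Not at hti
    obtain ⟨d', hd', hsum⟩ := ih (σ.erase t) (Finset.erase_ssubset ht)
      (fun t' ht' => h t' (Finset.mem_of_mem_erase ht'))
      (fun σ' hσ' => hσ σ' (hσ'.trans (Finset.erase_subset _ _)))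
    let S := ∑ j, d' j (e j t)
    have hS : (S : AddCircle (1 : ℚ)) = 0 := by
      rw [← h t ht]
      simp only [S, ← hd']
      exact map_sum (QuotientAddGroup.mk' (AddSubgroup.zmultiples (1 : ℚ))) _ _
    refine ⟨fun j w => d' j w - if j = i ∧ w = e j t then S else 0, fun j w => ?_,
      fun t' ht' => ?_⟩
    · rw [AddCircle.coe_sub, hd']
      split_ifs
      · rw [hS, sub_zero]
      · exact sub_zero _
    · rw [Finset.sum_sub_distrib]
      have : ∀ j, (if j = i ∧ e j t' = e j t then S else 0) =
          if j = i then (if e i t' = e i t then S else 0) else 0 := by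
        intro j
        by_cases hj : j = i
        · subst hj; simp
        · simp [hj]
      simp only [this, Finset.sum_ite_eq', Finset.mem_univ, if_true]
      by_cases htt : t' = t
      · subst htt; simp [S]
      · rw [hsum t' (Finset.mem_erase.2 ⟨htt, ht'⟩), if_neg (hti t' ht' htt), sub_zero]
  · push Not at hi
    rcases σ.eq_empty_or_nonempty with rfl | ⟨t₀, ht₀⟩
    · exact ⟨fun i w => s (d i w), fun i w => hs _, by simp⟩
    have hsum3 : ∀ {M : Type} [AddCommMonoid M] (F : Fin 3 → M),
        ∑ j, F j = F i + F (i + 1) + F (i + 2) := by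
      intro M _ F
      rw [Fin.sum_univ_three]
      fin_cases i
      · rfl
      · change F 0 + F 1 + F 2 = F 1 + F 2 + F 0; abel
      · change F 0 + F 1 + F 2 = F 2 + F 0 + F 1; abel
    have h1 : i + 1 ≠ i := by fin_cases i <;> decide
    have h2 : i + 2 ≠ i := by fin_cases i <;> decide
    have h12 : i + 1 ≠ i + 2 := by fin_cases i <;> decide
    let u := d i (e i t₀)
    -- All hyperedges share their vertex in part `i`, of value `u`. The value at the vertex in part
    -- `i + 1` is therefore `-d - u` for the value `d` in part `i + 2`, and applying `s` to this
    -- same element makes the sum cancel exactly.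
    refine ⟨fun j w => if j = i then s (d j w) else if j = i + 1 then s (d j w) else
      - s u - s (- d j w - u), fun j w => ?_, fun t ht => ?_⟩
    · dsimp only
      split_ifs
      · exact hs _
      · exact hs _
      · rw [AddCircle.coe_sub, AddCircle.coe_neg, hs, hs]; abel
    · rw [hsum3]
      simp only [h1, h2, h12.symm, if_true, if_false]
      have := h t ht
      rw [hsum3] at this
      have hu : d i (e i t) = u := by rw [hi t ht t₀ ht₀]
      rw [hu] at this ⊢
      rw [show d (i + 1) (e (i + 1) t) = - d (i + 2) (e (i + 2) t) - u by
        rw [← sub_eq_zero, ← this]; abel]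
      ring

/-- Two distinct vertices of one part lie in two hyperedges each, and a hyperedge meets a part only
once. -/
theorem IsThick.four_le_card {σ : Finset τ} (h : IsThick e σ) : 4 ≤ σ.card := by
  classical
  obtain ⟨h1, t, ht, u, hu, htu⟩ := h 0
  obtain ⟨t', ht', hne, he⟩ := h1 t ht
  obtain ⟨u', hu', hne', he'⟩ := h1 u hu
  have hsub : ({t, t', u, u'} : Finset τ) ⊆ σ := by
    intro x hx
    simp only [Finset.mem_insert, Finset.mem_singleton] at hx
    rcases hx with rfl | rfl | rfl | rfl <;> assumption
  have hcard : ({t, t', u, u'} : Finset τ).card = 4 := by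
    have a1 : t ≠ u := fun h => htu (by rw [h])
    have a2 : t ≠ u' := fun h => htu (by rw [← he', h])
    have a3 : t' ≠ u := fun h => htu (by rw [← he, h])
    have a4 : t' ≠ u' := fun h => htu (by rw [← he, ← he', h])
    rw [Finset.card_insert_of_notMem, Finset.card_insert_of_notMem, Finset.card_pair hne'.symm] <;>
      simp [a1, a2, a3, a4, hne.symm]
  exact hcard ▸ Finset.card_le_card hsub

end Hypergraph

/-- Comparability of two elements inside a subset of a poset. -/
def leOn {P : Type*} [LE P] (U : Set P) (a b : P) : Prop := a ∈ U ∧ b ∈ U ∧ a ≤ b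

/-- If a connected component of `U` is contained in `W`, its elements are connected in `W`. -/
theorem quot_mk_leOn_eq {P : Type*} [LE P] {U W : Set P} {a b : P}
    (h : Quot.mk (leOn U) a = Quot.mk (leOn U) b)
    (hW : ∀ z ∈ U, Quot.mk (leOn U) z = Quot.mk (leOn U) a → z ∈ W) :
    Quot.mk (leOn W) a = Quot.mk (leOn W) b := by
  replace h := Quot.eqvGen_exact h
  induction h with
  | rel x y hxy => exact Quot.sound ⟨hW x hxy.1 rfl, hW y hxy.2.1 (Quot.sound hxy).symm, hxy.2.2⟩
  | refl x => rfl
  | symm x y hxy ih =>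
    exact (ih fun z hz hzx => hW z hz (hzx.trans (Quot.eqvGen_sound hxy))).symm
  | trans x y z hxy hyz ih1 ih2 =>
    exact (ih1 hW).trans (ih2 fun w hw hwy => hW w hw (hwy.trans (Quot.eqvGen_sound hxy).symm))

/-- Cocycles lift on a poset with at most twelve elements of which at most three are minimal. -/
theorem cocyclesLift_of_three_minimal {P : Type*} [PartialOrder P] [Finite P]
    (hP : Nat.card P ≤ 12) (m : Fin 3 → P) (hm : ∀ x, IsMin x ↔ ∃ i, m i = x) :
    CocyclesLift P := by
  classical
  have := Fintype.ofFinite P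
  rw [Nat.card_eq_fintype_card] at hP
  intro c hc
  have hmin : ∀ i, IsMin (m i) := fun i => (hm _).2 ⟨i, rfl⟩
  let U : Fin 3 → Set P := fun i => {z | m (i + 1) ≤ z ∧ m (i + 2) ≤ z}
  let W : Set P := {z | ∀ i, m i ≤ z}
  have hWU : ∀ i, W ⊆ U i := fun i z hz => ⟨hz _, hz _⟩
  have hUU : ∀ i j, i ≠ j → U i ∩ U j ⊆ W := by
    rintro i j hij z ⟨⟨h1, h2⟩, h3, h4⟩ k
    fin_cases i <;> fin_cases j <;> first | exact absurd rfl hij | skip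
    all_goals fin_cases k <;> assumption
  -- On `U i` the difference of the two potentials is constant on components, and on `W` the three
  -- differences add up to zero. It is these differences that are lifted, keeping both properties.
  let D : Fin 3 → P → AddCircle (1 : ℚ) := fun i z =>
    if z ∈ U i then c (m (i + 1)) z - c (m (i + 2)) z else 0
  have hD : ∀ i a b, leOn (U i) a b → D i a = D i b := by
    rintro i a b ⟨ha, hb, hab⟩
    simp only [D, if_pos ha, if_pos hb]
    rw [← hc ha.1 hab, ← hc ha.2 hab]
    abel
  let e : ∀ i, Quot (leOn W) → Quot (leOn (U i)) := fun i =>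
    Quot.map id fun a b h => ⟨hWU i h.1, hWU i h.2.1, h.2.2⟩
  let σ : Finset (Quot (leOn W)) := (Finset.univ.filter (· ∈ W)).image (Quot.mk _)
  obtain ⟨d, hd, hdsum⟩ := exists_lift_of_forall_not_isThick e
    (fun i => Quot.lift (D i) (hD i)) σ (by
      intro t ht
      obtain ⟨z, hz, rfl⟩ := Finset.mem_image.1 ht
      have hz := (Finset.mem_filter.1 hz).2
      change ∑ i, D i z = 0
      rw [Fin.sum_univ_three]
      simp only [D, if_pos (hWU _ hz)]
      change c (m 1) z - c (m 2) z + (c (m 2) z - c (m 0) z) + (c (m 0) z - c (m 1) z) = 0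
      abel) (by
    intro σ' hσ' hthick
    have hcardW : 4 ≤ (Finset.univ.filter (· ∈ W)).card :=
      (hthick.four_le_card e).trans ((Finset.card_le_card hσ').trans Finset.card_image_le)
    -- By thickness, the component of `U i` containing `t` contains a second component of `W`. It
    -- therefore cannot lie inside `W`, where it would connect the two.
    have hU : ∀ i, ∀ t ∈ σ', ∃ z, z ∈ U i ∧ z ∉ W ∧ Quot.mk (leOn (U i)) z = e i t := by
      intro i t ht
      obtain ⟨t', ht', hne, he⟩ := (hthick i).1 t ht
      obtain ⟨a, -, rfl⟩ := Finset.mem_image.1 (hσ' ht)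
      obtain ⟨b, -, rfl⟩ := Finset.mem_image.1 (hσ' ht')
      by_contra hcon
      push Not at hcon
      refine hne (quot_mk_leOn_eq (U := U i) he fun z hz hzb => ?_)
      by_contra hzW
      exact hcon z hz hzW (hzb.trans he)
    have hcardU : ∀ i, 2 ≤ (Finset.univ.filter (fun z => z ∈ U i ∧ z ∉ W)).card := by
      intro i
      obtain ⟨-, t, ht, t', ht', hne⟩ := hthick i
      obtain ⟨z, hz, hzW, hzt⟩ := hU i t ht
      obtain ⟨z', hz', hzW', hzt'⟩ := hU i t' ht'
      refine Finset.one_lt_card.2 ⟨z, by simp [hz, hzW], z', by simp [hz', hzW'], ?_⟩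
      rintro rfl
      exact hne (hzt.symm.trans hzt')
    -- If `m i = m j` with `i ≠ j`, an element of `U j` lies above all three minimal elements, so `U
    -- j \ W` would be empty.
    have hinj : Function.Injective m := by
      have : ∀ i j, i ≠ j → m i ≠ m j := by
        intro i j hij hmij
        obtain ⟨z, hz⟩ := Finset.card_pos.1 (lt_of_lt_of_le two_pos (hcardU j))
        obtain ⟨⟨h1, h2⟩, hzW⟩ := (Finset.mem_filter.1 hz).2
        refine hzW fun k => ?_
        have h3 : m i ≤ z → m j ≤ z := fun h => hmij ▸ h
        fin_cases i <;> fin_cases j <;> first | exact absurd rfl hij | skip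
        all_goals fin_cases k <;> first | assumption | exact h3 h1 | exact h3 h2
      intro i j h
      by_contra hij
      exact this i j hij h
    have hmU : ∀ i j, m j ∉ U i := by
      rintro i j ⟨h1, h2⟩
      have e1 := hinj ((hmin j).eq_of_ge h1)
      have e2 := hinj ((hmin j).eq_of_ge h2)
      rw [e1] at e2
      fin_cases i <;> exact absurd e2 (by decide)
    let M : Finset P := Finset.univ.image m
    have hM : M.card = 3 := by rw [Finset.card_image_of_injective _ hinj]; rfl
    let A : Finset P := Finset.univ.filter (· ∈ W)
    let B : Fin 3 → Finset P := fun i => Finset.univ.filter (fun z => z ∈ U i ∧ z ∉ W)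
    have d1 : Disjoint M A := by
      refine Finset.disjoint_left.2 fun z hz hz' => ?_
      obtain ⟨j, -, rfl⟩ := Finset.mem_image.1 hz
      exact hmU 0 j (hWU 0 (Finset.mem_filter.1 hz').2)
    have d2 : Disjoint (M ∪ A) (Finset.univ.biUnion B) := by
      refine Finset.disjoint_left.2 fun z hz hz' => ?_
      obtain ⟨i, -, hi⟩ := Finset.mem_biUnion.1 hz'
      have hi := (Finset.mem_filter.1 hi).2
      rcases Finset.mem_union.1 hz with h | h
      · obtain ⟨j, -, rfl⟩ := Finset.mem_image.1 h
        exact hmU i j hi.1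
      · exact hi.2 (Finset.mem_filter.1 h).2
    have d3 : 6 ≤ (Finset.univ.biUnion B).card := by
      rw [Finset.card_biUnion]
      · exact (Finset.sum_le_sum fun i _ => hcardU i).trans' (by simp)
      · intro i _ j _ hij
        refine Finset.disjoint_left.2 fun z hz hz' => ?_
        have h1 := (Finset.mem_filter.1 hz).2
        have h2 := (Finset.mem_filter.1 hz').2
        exact h1.2 (hUU i j hij ⟨h1.1, h2.1⟩)
    -- The disjoint sets contribute 3 minimal elements, at least 4 elements of `W` and at least 2 of
    -- each `U i \ W`: thirteen, one too many.
    have := Finset.card_le_univ (M ∪ A ∪ Finset.univ.biUnion B)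
    rw [Finset.card_union_of_disjoint d2, Finset.card_union_of_disjoint d1, hM] at this
    have h4 : 4 ≤ A.card := hcardW
    omega)
  let F : Fin 3 → P → ℚ := fun i z => d i (Quot.mk _ z)
  have hFle : ∀ i z z', z ∈ U i → z ≤ z' → F i z = F i z' := by
    intro i z z' hz hzz
    exact congrArg (d i) (Quot.sound ⟨hz, ⟨hz.1.trans hzz, hz.2.trans hzz⟩, hzz⟩)
  have hFc : ∀ i z, z ∈ U i → (F i z : AddCircle (1 : ℚ)) = c (m (i + 1)) z - c (m (i + 2)) z := by
    intro i z hz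
    rw [hd i (Quot.mk _ z)]
    exact if_pos hz
  have hFW : ∀ z ∈ W, F 0 z + F 1 z + F 2 z = 0 := by
    intro z hz
    have := hdsum (Quot.mk _ z) (Finset.mem_image.2 ⟨z, by simpa using hz, rfl⟩)
    rwa [Fin.sum_univ_three] at this
  -- The lifted differences are integrated to potentials at each `z` separately. They are constant
  -- along `z ≤ z'`, so the increment of `α` does not depend on the minimal element.
  have hα : ∀ z, ∃ α : Fin 3 → ℚ, (∀ i, (α i : AddCircle (1 : ℚ)) = c (m i) z) ∧
      ∀ i, z ∈ U i → α (i + 1) - α (i + 2) = F i z := by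
    intro z
    obtain ⟨a, b, c, ha, hb, hc', h01, h12, h02⟩ := exists_lift_triple
      (l₀₁ := z ∈ U 2) (l₁₂ := z ∈ U 0) (l₀₂ := z ∈ U 1)
      (e₀₁ := F 2 z) (e₁₂ := F 0 z) (e₀₂ := - F 1 z)
      (φ₀ := c (m 0) z) (φ₁ := c (m 1) z) (φ₂ := c (m 2) z) (fun h => hFc 2 z h)
      (fun h => hFc 0 z h) (fun h => by
        rw [AddCircle.coe_neg, hFc 1 z h]
        exact neg_sub _ _) (fun h1 h2 _ => by
        have := hFW z (hUU 2 0 (by decide) ⟨h1, h2⟩)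
        linarith)
    refine ⟨![a, b, c], fun i => by fin_cases i <;> assumption, fun i hi => ?_⟩
    fin_cases i
    · exact h12 hi
    · have := h02 hi
      change c - a = F 1 z
      linarith
    · exact h01 hi
  choose α hα1 hα2 using hα
  have hidx : ∀ x, ∃ i, IsMin x → m i = x := fun x => by
    by_cases hx : IsMin x
    · obtain ⟨i, hi⟩ := (hm x).1 hx
      exact ⟨i, fun _ => hi⟩
    · exact ⟨0, fun h => absurd h hx⟩
  choose idx hidx using hidx
  refine exists_lift_of_minimal hc (fun x z => α z (idx x)) (fun x z hx hxz => ?_) ?_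
  · rw [hα1, hidx x hx]
  · intro x x' z z' hx hx' hxz hxz' hzz
    have key : ∀ i, z ∈ U i → α z' (i + 1) - α z (i + 1) = α z' (i + 2) - α z (i + 2) := by
      intro i hi
      have h1 := hα2 z i hi
      have h2 := hα2 z' i ⟨hi.1.trans hzz, hi.2.trans hzz⟩
      rw [hFle i z z' hi hzz] at h1
      linarith
    rw [← hidx x hx] at hxz
    rw [← hidx x' hx'] at hxz'
    generalize idx x = i at *
    generalize idx x' = j at *
    have : j = i ∨ (i = j + 1) ∨ i = j + 2 := by
      clear * -
      fin_cases i <;> fin_cases j <;> decide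
    rcases this with rfl | rfl | rfl
    · rfl
    · have := key (j + 2) (by
        refine ⟨?_, ?_⟩
        · rwa [show j + 2 + 1 = j by fin_cases j <;> rfl]
        · rwa [show j + 2 + 2 = j + 1 by fin_cases j <;> rfl])
      rw [show j + 2 + 1 = j by fin_cases j <;> rfl,
        show j + 2 + 2 = j + 1 by fin_cases j <;> rfl] at this
      exact this.symm
    · have := key (j + 1) (by
        refine ⟨?_, ?_⟩
        · rwa [show j + 1 + 1 = j + 2 by fin_cases j <;> rfl]
        · rwa [show j + 1 + 2 = j by fin_cases j <;> rfl])
      rw [show j + 1 + 1 = j + 2 by fin_cases j <;> rfl,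
        show j + 1 + 2 = j by fin_cases j <;> rfl] at this
      exact this

/-! ### The case distinction for at most twelve elements -/

theorem cocyclesLift_of_card_minimal_le {P : Type*} [PartialOrder P] [Finite P] [Nonempty P]
    (hP : Nat.card P ≤ 12) (h : Nat.card {x : P // IsMin x} ≤ 3) : CocyclesLift P := by
  classical
  have := Fintype.ofFinite {x : P // IsMin x}
  rw [Nat.card_eq_fintype_card] at h
  obtain ⟨f⟩ : Nonempty ({x : P // IsMin x} ↪ Fin 3) :=
    Function.Embedding.nonempty_of_card_le (by simpa using h)
  obtain ⟨x₀, hx₀⟩ := (Set.toFinite (Set.univ : Set P)).exists_minimal Set.univ_nonempty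
  have : Nonempty {x : P // IsMin x} := ⟨⟨x₀, fun y hy => hx₀.2 (Set.mem_univ y) hy⟩⟩
  refine cocyclesLift_of_three_minimal hP (fun i => (Function.invFun f i : {x : P // IsMin x}))
    fun x => ⟨fun hx => ⟨f ⟨x, hx⟩, ?_⟩, ?_⟩
  · rw [Function.leftInverse_invFun f.injective]
  · rintro ⟨i, rfl⟩
    exact (Function.invFun f i).2

theorem CocyclesLift.of_dual {P : Type*} [PartialOrder P] (h : CocyclesLift Pᵒᵈ) :
    CocyclesLift P := by
  intro c hc
  obtain ⟨d, hd, hdc⟩ := h (fun x y => c (OrderDual.ofDual y) (OrderDual.ofDual x))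
    (fun x y z hxy hyz => by
      dsimp only
      rw [add_comm]
      exact hc (OrderDual.ofDual_le_ofDual.2 hyz) (OrderDual.ofDual_le_ofDual.2 hxy))
  refine ⟨fun x y => d (OrderDual.toDual y) (OrderDual.toDual x), fun x y z hxy hyz => ?_,
    fun x y hxy => ?_⟩
  · dsimp only
    rw [add_comm]
    exact hd (OrderDual.toDual_le_toDual.2 hyz) (OrderDual.toDual_le_toDual.2 hxy)
  · exact hdc (OrderDual.toDual_le_toDual.2 hxy)

/-- Adding an isolated element does not affect the lifting of cocycles. -/
theorem CocyclesLift.of_isolated {P : Type*} [PartialOrder P] {x : P} (hmin : IsMin x)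
    (hmax : IsMax x) (h : CocyclesLift {y : P // y ≠ x}) : CocyclesLift P := by
  classical
  intro c hc
  obtain ⟨d, hd, hdc⟩ := h (fun y z => c y z) fun y z w hyz hzw => hc hyz hzw
  refine ⟨fun y z => if hy : y ≠ x then if hz : z ≠ x then d ⟨y, hy⟩ ⟨z, hz⟩ else 0 else 0,
    fun y z w hyz hzw => ?_, fun y z hyz => ?_⟩
  · by_cases hy : y = x
    · subst hy
      obtain rfl := hmax.eq_of_le hyz
      simp
    · have hz : z ≠ x := fun h => hy (hmin.eq_of_le (h ▸ hyz))
      have hw : w ≠ x := fun h => hz (hmin.eq_of_le (h ▸ hzw))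
      simp only [dif_pos hy, dif_pos hz, dif_pos hw]
      exact hd (x := ⟨y, hy⟩) (y := ⟨z, hz⟩) (z := ⟨w, hw⟩) hyz hzw
  · by_cases hy : y = x
    · subst hy
      obtain rfl := hmax.eq_of_le hyz
      simp [hc.self]
    · have hz : z ≠ x := fun h => hy (hmin.eq_of_le (h ▸ hyz))
      simp only [dif_pos hy, dif_pos hz]
      exact hdc (x := ⟨y, hy⟩) (y := ⟨z, hz⟩) hyz

/-- Cocycles lift on every poset with at most twelve elements. -/
theorem cocyclesLift_of_card_le {P : Type*} [PartialOrder P] [Finite P]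
    (hP : Nat.card P ≤ 12) : CocyclesLift P := by
  classical
  induction hn : Nat.card P using Nat.strong_induction_on generalizing P with | _ n ih =>
  rcases isEmpty_or_nonempty P with hE | hE
  · exact fun c _ => ⟨fun x => isEmptyElim x, fun x => isEmptyElim x, fun x => isEmptyElim x⟩
  by_cases h1 : Nat.card {x : P // IsMin x} ≤ 3
  · exact cocyclesLift_of_card_minimal_le hP h1
  by_cases h2 : Nat.card {x : P // IsMax x} ≤ 3
  · apply CocyclesLift.of_dual
    refine cocyclesLift_of_card_minimal_le (P := Pᵒᵈ) hP (le_trans (le_of_eq ?_) h2)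
    exact Nat.card_congr (OrderDual.ofDual.subtypeEquiv fun x => isMax_ofDual_iff.symm)
  by_cases h3 : ∃ x : P, IsMin x ∧ IsMax x
  · obtain ⟨x, hmin, hmax⟩ := h3
    have hlt : Nat.card {y : P // y ≠ x} < Nat.card P := Finite.card_subtype_lt (x := x) (by simp)
    exact .of_isolated hmin hmax (ih _ (hn ▸ hlt) (hlt.le.trans hP) rfl)
  -- At least four minimal and four maximal elements, all distinct, leave at most `12 - 8 = 4` in
  -- the middle.
  · apply cocyclesLift_of_card_middle_le
    push Not at h3
    have := Fintype.ofFinite P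
    simp only [Nat.card_eq_fintype_card, Fintype.card_subtype] at *
    have hd : Disjoint (Finset.univ.filter fun x : P => IsMin x)
        (Finset.univ.filter fun x : P => IsMax x) :=
      Finset.disjoint_left.2 fun x hx hx' =>
        h3 x (Finset.mem_filter.1 hx).2 (Finset.mem_filter.1 hx').2
    have hd' : Disjoint ((Finset.univ.filter fun x : P => IsMin x) ∪
        (Finset.univ.filter fun x : P => IsMax x))
        (Finset.univ.filter fun x : P => ¬ IsMin x ∧ ¬ IsMax x) := by
      refine Finset.disjoint_left.2 fun x hx hx' => ?_
      have hx' := (Finset.mem_filter.1 hx').2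
      rcases Finset.mem_union.1 hx with h | h
      · exact hx'.1 (Finset.mem_filter.1 h).2
      · exact hx'.2 (Finset.mem_filter.1 h).2
    have := Finset.card_le_univ (((Finset.univ.filter fun x : P => IsMin x) ∪
      (Finset.univ.filter fun x : P => IsMax x)) ∪
      (Finset.univ.filter fun x : P => ¬ IsMin x ∧ ¬ IsMax x))
    rw [Finset.card_union_of_disjoint hd', Finset.card_union_of_disjoint hd] at this
    omega

/-! ### The double covering of the projective plane and Borsuk–Ulam -/

section ProjectivePlane

open scoped unitInterval

/-- The unit sphere in `ℝ³`. -/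
abbrev TwoSphere : Type := Metric.sphere (0 : EuclideanSpace ℝ (Fin 3)) 1

/-- The quotient map from the sphere to the projective plane. -/
def projMap (x : TwoSphere) : RealProjectivePlane := Quotient.mk antipodalSetoid x

theorem continuous_projMap : Continuous projMap := continuous_quotient_mk'

theorem projMap_surjective : Function.Surjective projMap := Quotient.mk_surjective

theorem projMap_eq_iff {x y : TwoSphere} : projMap x = projMap y ↔ x = y ∨ x = -y :=
  Quotient.eq (r := antipodalSetoid)

theorem projMap_neg (x : TwoSphere) : projMap (-x) = projMap x :=
  projMap_eq_iff.2 (Or.inr rfl)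

theorem TwoSphere.inner_self (x : TwoSphere) :
    inner ℝ (x : EuclideanSpace ℝ (Fin 3)) x = 1 := by
  rw [real_inner_self_eq_norm_sq, norm_eq_of_mem_sphere, one_pow]

theorem TwoSphere.ne_neg (x : TwoSphere) : x ≠ -x := by
  intro h
  have h1 := TwoSphere.inner_self x
  have h2 : inner ℝ (x : EuclideanSpace ℝ (Fin 3)) ((-x : TwoSphere) : EuclideanSpace ℝ (Fin 3))
    = 1 := by rw [← h]; exact h1
  rw [coe_neg_sphere, inner_neg_right, h1] at h2
  norm_num at h2

/-- The antipodal action of `{1, -1}` on the sphere. -/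
@[reducible] noncomputable def antipodalAction : MulAction ℤˣ TwoSphere where
  smul u x := if u = 1 then x else -x
  one_smul x := if_pos rfl
  mul_smul u v x := by
    change (if u * v = 1 then x else -x) = if u = 1 then (if v = 1 then x else -x) else
      -(if v = 1 then x else -x)
    rcases Int.units_eq_one_or u with rfl | rfl <;> rcases Int.units_eq_one_or v with rfl | rfl <;>
      simp

/-- The open hemisphere around a point is disjoint from its antipode, so the action of `{1, -1}` is
properly discontinuous. -/
theorem isCoveringMap_projMap : IsCoveringMap projMap := by
  let := antipodalAction
  have smul_def : ∀ (u : ℤˣ) (x : TwoSphere), u • x = if u = 1 then x else -x := fun _ _ => rfl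
  have hq : IsQuotientCoveringMap projMap ℤˣ :=
    { toIsQuotientMap := isQuotientMap_quotient_mk'
      continuous_const_smul := fun u => by
        rcases Int.units_eq_one_or u with rfl | rfl
        · simpa only [smul_def, if_true] using continuous_id'
        · simpa [smul_def] using (continuous_neg : Continuous fun x : TwoSphere => -x)
      apply_eq_iff_mem_orbit := fun {x y} => by
        rw [projMap_eq_iff]
        constructor
        · rintro (rfl | rfl)
          · exact ⟨1, by simp⟩
          · exact ⟨-1, by simp [smul_def]⟩
        · rintro ⟨u, rfl⟩
          rcases Int.units_eq_one_or u with rfl | rfl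
          · left; simp
          · right; simp [smul_def]
      disjoint := fun e => by
        refine ⟨{x | 0 < inner ℝ (x : EuclideanSpace ℝ (Fin 3)) e}, ?_, fun u hu => ?_⟩
        · refine IsOpen.mem_nhds (isOpen_lt continuous_const (by fun_prop)) ?_
          simp only [Set.mem_ofPred_eq, TwoSphere.inner_self]
          exact one_pos
        · rcases Int.units_eq_one_or u with rfl | rfl
          · rfl
          · obtain ⟨_, ⟨x, hx, rfl⟩, hx'⟩ := hu
            simp only [smul_def, Set.mem_ofPred_eq] at hx hx'
            rw [if_neg (by decide), coe_neg_sphere, inner_neg_left] at hx'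
            linarith }
  exact hq.isCoveringMap

/-- Maps from star-shaped sets lift through covering maps. -/
theorem IsCoveringMap.exists_lift_of_starConvex {E X F : Type*} [TopologicalSpace E]
    [TopologicalSpace X] [AddCommGroup F] [Module ℝ F] [TopologicalSpace F] [ContinuousAdd F]
    [ContinuousSMul ℝ F] {p : E → X} (hp : IsCoveringMap p) (hsurj : Function.Surjective p)
    {A : Set F} {a₀ : F} (ha₀ : a₀ ∈ A) (hA : StarConvex ℝ a₀ A) (f : C(A, X)) :
    ∃ L : C(A, E), ∀ a, p (L a) = f a := by
  -- The contraction to `a₀`, run backwards: `f ∘ h` starts at a constant map, which lifts, and ends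
  -- at `f`.
  let h : C(I × A, A) :=
    ⟨fun z => ⟨(1 - (z.1 : ℝ)) • a₀ + (z.1 : ℝ) • (z.2 : F),
      hA z.2.2 (sub_nonneg.2 z.1.2.2) z.1.2.1 (by ring)⟩, by fun_prop⟩
  obtain ⟨e, he⟩ := hsurj (f ⟨a₀, ha₀⟩)
  have h0 : ∀ a, (f.comp h) (0, a) = p ((ContinuousMap.const A e) a) := by
    intro a
    have : h (0, a) = ⟨a₀, ha₀⟩ := by
      apply Subtype.ext
      simp [h]
    simp only [ContinuousMap.comp_apply, this, ContinuousMap.const_apply, he]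
  refine ⟨(hp.liftHomotopy (f.comp h) (ContinuousMap.const A e) h0).comp
    ⟨fun a => ((1 : I), a), by fun_prop⟩, fun a => ?_⟩
  have := congr_fun (hp.liftHomotopy_lifts (f.comp h) (ContinuousMap.const A e) h0) (1, a)
  refine this.trans ?_
  have h1 : h (1, a) = a := by
    apply Subtype.ext
    simp [h]
  simp only [ContinuousMap.comp_apply, h1]

/-- A point of the upper hemisphere given by its projection to the disc. -/
noncomputable def hemisphere (z : Metric.closedBall (0 : ℂ) 1) : TwoSphere :=
  ⟨!₂[(z : ℂ).re, (z : ℂ).im, √(1 - ‖(z : ℂ)‖ ^ 2)], by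
    have hz : ‖(z : ℂ)‖ ≤ 1 := mem_closedBall_zero_iff.1 z.2
    have h1 : 0 ≤ 1 - ‖(z : ℂ)‖ ^ 2 := by nlinarith [norm_nonneg (z : ℂ)]
    rw [mem_sphere_zero_iff_norm, EuclideanSpace.norm_eq, Real.sqrt_eq_one, Fin.sum_univ_three]
    simp only [Matrix.cons_val_zero, Matrix.cons_val_one, Matrix.cons_val,
      Real.norm_eq_abs, sq_abs, Real.sq_sqrt h1]
    rw [Complex.sq_norm, Complex.normSq_apply]
    ring⟩

theorem continuous_hemisphere : Continuous hemisphere := by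
  refine Continuous.subtype_mk ?_ _
  refine (PiLp.continuous_toLp 2 _).comp (continuous_pi fun i => ?_)
  fin_cases i
  · exact Complex.continuous_re.comp continuous_subtype_val
  · exact Complex.continuous_im.comp continuous_subtype_val
  · exact ((continuous_const.sub ((continuous_norm.comp continuous_subtype_val).pow 2)).sqrt)

/-- There is no odd map from the sphere to the circle. -/
theorem not_exists_odd_map (Φ : C(TwoSphere, AddCircle (2 : ℝ)))
    (hΦ : ∀ s, Φ (-s) = Φ s + ((1 : ℝ) : AddCircle (2 : ℝ))) : False := by
  have : Fact ((0 : ℝ) < 2) := ⟨two_pos⟩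
  obtain ⟨φ, hφ⟩ := (AddCircle.isCoveringMap_coe (2 : ℝ)).exists_lift_of_starConvex
    QuotientAddGroup.mk_surjective (a₀ := 0) (A := Metric.closedBall (0 : ℂ) 1) (by simp)
    ((convex_closedBall (0 : ℂ) 1).starConvex (by simp))
    (Φ.comp ⟨hemisphere, continuous_hemisphere⟩)
  have hmem : ∀ θ : ℝ, Complex.exp (θ * Complex.I) ∈ Metric.closedBall (0 : ℂ) 1 := fun θ => by
    simp [Complex.norm_exp_ofReal_mul_I]
  let b : ℝ → Metric.closedBall (0 : ℂ) 1 := fun θ => ⟨Complex.exp (θ * Complex.I), hmem θ⟩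
  have hb : Continuous b := by
    refine Continuous.subtype_mk ?_ _
    fun_prop
  have hbπ : ∀ θ, ((b (θ + Real.pi)) : ℂ) = - (b θ : ℂ) := fun θ => by
    simp [b, add_mul, Complex.exp_add, Complex.exp_pi_mul_I]
  have hneg : ∀ θ, hemisphere (b (θ + Real.pi)) = - hemisphere (b θ) := fun θ => by
    apply Subtype.ext
    rw [coe_neg_sphere]
    have h1 : ‖(b θ : ℂ)‖ = 1 := Complex.norm_exp_ofReal_mul_I θ
    ext i
    simp only [hemisphere, hbπ, norm_neg, h1]
    fin_cases i <;> simp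
  -- Antipodal points of the equator: oddness gives `ψ θ ≡ 1` modulo 2, so `ψ` never vanishes,
  -- whereas a half turn changes its sign.
  let ψ : ℝ → ℝ := fun θ => φ (b (θ + Real.pi)) - φ (b θ)
  have hψc : Continuous ψ := by fun_prop
  have hψ : ∀ θ, ψ θ ≠ 0 := by
    intro θ h0
    have h1 : ((ψ θ : ℝ) : AddCircle (2 : ℝ)) = ((1 : ℝ) : AddCircle (2 : ℝ)) := by
      have h2 := hφ (b (θ + Real.pi))
      have h3 := hφ (b θ)
      simp only [ContinuousMap.comp_apply, ContinuousMap.coe_mk] at h2 h3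
      rw [hneg, hΦ, ← h3] at h2
      rw [AddCircle.coe_sub, h2]
      abel
    rw [h0, AddCircle.coe_eq_coe_iff_of_mem_Ico (a := 0) (by norm_num) (by norm_num)] at h1
    norm_num at h1
  have hψπ : ψ (0 + Real.pi) = - ψ 0 := by
    have : b (0 + Real.pi + Real.pi) = b 0 := by
      apply Subtype.ext
      rw [hbπ, hbπ, neg_neg]
    simp only [ψ, this]
    ring
  rcases lt_or_gt_of_ne (hψ 0) with h | h
  · obtain ⟨θ, hθ⟩ := mem_range_of_exists_le_of_exists_ge hψc ⟨0, h.le⟩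
      ⟨0 + Real.pi, by rw [hψπ]; linarith⟩
    exact hψ θ hθ
  · obtain ⟨θ, hθ⟩ := mem_range_of_exists_le_of_exists_ge hψc
      ⟨0 + Real.pi, show _ ≤ (0 : ℝ) by rw [hψπ]; linarith⟩ ⟨0, h.le⟩
    exact hψ θ hθ

/-- A self-map of the projective plane homotopic to the identity lifts to an odd self-map of the
sphere. -/
theorem exists_odd_lift {F : C(RealProjectivePlane, RealProjectivePlane)}
    (H : ContinuousMap.Homotopy (ContinuousMap.id _) F) :
    ∃ h : C(TwoSphere, TwoSphere), (∀ s, projMap (h s) = F (projMap s)) ∧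
      ∀ s, h (-s) = - h s := by
  let q : C(TwoSphere, RealProjectivePlane) := ⟨projMap, continuous_projMap⟩
  let H' : C(I × TwoSphere, RealProjectivePlane) :=
    H.toContinuousMap.comp ((ContinuousMap.id I).prodMap q)
  have h0 : ∀ s, H' (0, s) = projMap (ContinuousMap.id TwoSphere s) := fun s => H.apply_zero _
  let G := isCoveringMap_projMap.liftHomotopy H' (ContinuousMap.id _) h0
  have hG : ∀ t s, projMap (G (t, s)) = H (t, projMap s) := fun t s =>
    congr_fun (isCoveringMap_projMap.liftHomotopy_lifts H' (ContinuousMap.id _) h0) (t, s)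
  have hG0 : ∀ s, G (0, s) = s :=
    isCoveringMap_projMap.liftHomotopy_zero H' (ContinuousMap.id _) h0
  -- Conjugating by the antipode gives another lift of the same homotopy, also starting at the
  -- identity; by uniqueness it equals `G`.
  let G' : C(I × TwoSphere, TwoSphere) := ⟨fun z => - G (z.1, -z.2), by fun_prop⟩
  have hGG : G' = G := by
    refine (isCoveringMap_projMap.eq_liftHomotopy_iff' h0 G').2 ⟨?_, fun s => ?_⟩
    · ext ⟨t, s⟩
      change projMap (- G (t, -s)) = H (t, projMap s)
      rw [projMap_neg, hG, projMap_neg]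
    · change - G (0, -s) = s
      rw [hG0, neg_neg]
  refine ⟨G.comp ⟨fun s => ((1 : I), s), by fun_prop⟩, fun s => ?_, fun s => ?_⟩
  · exact (hG 1 s).trans (H.apply_one _)
  · have := DFunLike.congr_fun hGG (1, s)
    change - G (1, -s) = G (1, s) at this
    change G (1, -s) = - G (1, s)
    rw [← this, neg_neg]

end ProjectivePlane

/-! ### Torsion in complexes homotopy equivalent to the projective plane -/

namespace AbstractSimplicialComplex

variable {V : Type*} [Fintype V] {K : AbstractSimplicialComplex V}

/-- The open star of a vertex in the geometric realization. -/
def openStar (K : AbstractSimplicialComplex V) (u : V) : Set (V → ℝ) :=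
  {x | x ∈ K.realization ∧ x u ≠ 0}

theorem single_mem_openStar [DecidableEq V] (u : V) : Pi.single u 1 ∈ K.openStar u := by
  refine ⟨⟨single_mem_stdSimplex ℝ u, {u}, K.singleton_mem u, fun v hv => ?_⟩, by simp⟩
  by_contra hvu
  exact hv (Pi.single_eq_of_ne (by simpa using hvu) _)

/-- Segments from a point of the realization to a point whose support is contained in the support
of the former stay in the realization. -/
theorem segment_mem_realization {x y : V → ℝ} (hy : y ∈ K.realization) (hx : x ∈ stdSimplex ℝ V)
    (hxy : ∀ v, x v ≠ 0 → y v ≠ 0) {a b : ℝ} (ha : 0 ≤ a) (hb : 0 ≤ b) (hab : a + b = 1) :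
    a • x + b • y ∈ K.realization := by
  obtain ⟨hys, s, hs, hsy⟩ := hy
  refine ⟨convex_stdSimplex ℝ V hx hys ha hb hab, s, hs, fun v hv => hsy v fun h => ?_⟩
  by_cases hxv : x v = 0
  · simp [hxv, h] at hv
  · exact hxy v hxv h

theorem starConvex_openStar [DecidableEq V] (u : V) :
    StarConvex ℝ (Pi.single u 1) (K.openStar u) := by
  intro y hy a b ha hb hab
  refine ⟨segment_mem_realization hy.1 (single_mem_stdSimplex ℝ u) (fun v hv => ?_) ha hb hab, ?_⟩
  · by_cases hvu : v = u
    · exact hvu ▸ hy.2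
    · exact absurd (Pi.single_eq_of_ne hvu _) hv
  · have hpos : 0 < y u := lt_of_le_of_ne (hy.1.1.1 u) hy.2.symm
    simp only [Pi.add_apply, Pi.smul_apply, Pi.single_eq_same, smul_eq_mul, mul_one]
    rcases ha.eq_or_lt with rfl | ha
    · rw [zero_add] at hab
      rw [hab]
      simpa using hpos.ne'
    · positivity

/-- When nonempty, the intersection is star-shaped about the midpoint of `u` and `v`. Connectedness
makes the sign between the lifts over two open stars constant. -/
theorem isPreconnected_openStar_inter [DecidableEq V] (u v : V) :
    IsPreconnected (K.openStar u ∩ K.openStar v) := by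
  let m : V → ℝ := (1 / 2 : ℝ) • Pi.single u 1 + (1 / 2 : ℝ) • Pi.single v 1
  have hm : m ∈ stdSimplex ℝ V := convex_stdSimplex ℝ V (single_mem_stdSimplex ℝ u)
    (single_mem_stdSimplex ℝ v) (by norm_num) (by norm_num) (by norm_num)
  rcases (K.openStar u ∩ K.openStar v).eq_empty_or_nonempty with h | h
  · exact h ▸ isPreconnected_empty
  suffices hstar : StarConvex ℝ m (K.openStar u ∩ K.openStar v) by
    obtain ⟨y, hy⟩ := h
    have hmm := hstar hy zero_le_one le_rfl (add_zero (1 : ℝ))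
    rw [one_smul, zero_smul, add_zero] at hmm
    exact (hstar.isPathConnected hmm).isConnected.isPreconnected
  intro y hy a b ha hb hab
  have hmem : a • m + b • y ∈ K.realization := by
    refine segment_mem_realization hy.1.1 hm (fun w hw => ?_) ha hb hab
    by_cases hwu : w = u
    · exact hwu ▸ hy.1.2
    by_cases hwv : w = v
    · exact hwv ▸ hy.2.2
    simp [m, hwu, hwv] at hw
  have key : ∀ w, 0 < m w → y w ≠ 0 → (a • m + b • y) w ≠ 0 := by
    intro w hmw hyw
    have hpos : 0 < y w := lt_of_le_of_ne (hy.1.1.1.1 w) hyw.symm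
    simp only [Pi.add_apply, Pi.smul_apply, smul_eq_mul]
    rcases ha.eq_or_lt with rfl | ha
    · rw [zero_add] at hab
      rw [hab]
      simpa using hpos.ne'
    · positivity
  have hnn : ∀ w w' : V, (0 : ℝ) ≤ (Pi.single w 1 : V → ℝ) w' := fun w w' =>
    (single_mem_stdSimplex ℝ w).1 w'
  refine ⟨⟨hmem, key u ?_ hy.1.2⟩, hmem, key v ?_ hy.2.2⟩
  · have := hnn v u
    simp only [m, Pi.add_apply, Pi.smul_apply, Pi.single_eq_same, smul_eq_mul]
    linarith
  · have := hnn u v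
    simp only [m, Pi.add_apply, Pi.smul_apply, Pi.single_eq_same, smul_eq_mul]
    linarith

/-- The vertices of a face have a common point in their open stars. -/
theorem exists_mem_openStar {s : Finset V} (hs : s ∈ K.faces) :
    ∃ x, ∀ u ∈ s, x ∈ K.openStar u := by
  classical
  have hne : s.Nonempty := (K.isRelLowerSet_faces hs).1
  have hpos : (0 : ℝ) < s.card := by exact_mod_cast hne.card_pos
  let x : V → ℝ := fun v => if v ∈ s then (s.card : ℝ)⁻¹ else 0
  have hx : x ∈ K.realization := by
    refine ⟨⟨fun v => ?_, ?_⟩, s, hs, fun v hv => ?_⟩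
    · simp only [x]
      split_ifs
      · positivity
      · exact le_rfl
    · simp [x, Finset.sum_ite_mem, hpos.ne']
    · by_contra h
      exact hv (if_neg h)
  exact ⟨x, fun u hu => ⟨hx, by simp [x, hu, hpos.ne']⟩⟩

/-- Flip a point of the sphere according to a sign. -/
noncomputable def flip (a : ZMod 2) (s : TwoSphere) : TwoSphere := if a = 0 then s else -s

theorem flip_add (a b : ZMod 2) (s : TwoSphere) : flip (a + b) s = flip a (flip b s) := by
  have h01 : ∀ a : ZMod 2, a = 0 ∨ a = 1 := by decide
  rcases h01 a with rfl | rfl <;> rcases h01 b with rfl | rfl <;>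
    simp [flip, show (1 + 1 : ZMod 2) = 0 from by decide]

theorem flip_injective {a b : ZMod 2} {s : TwoSphere} (h : flip a s = flip b s) : a = b := by
  have h01 : ∀ a : ZMod 2, a = 0 ∨ a = 1 := by decide
  rcases h01 a with rfl | rfl <;> rcases h01 b with rfl | rfl
  · rfl
  · simp [flip] at h; exact absurd h s.ne_neg
  · simp [flip] at h; exact absurd h.symm s.ne_neg
  · rfl

theorem inner_flip (a : ZMod 2) (s t : TwoSphere) :
    inner ℝ (s : EuclideanSpace ℝ (Fin 3)) (flip a t) =
      (1 - 2 * (a.val : ℝ)) * inner ℝ (s : EuclideanSpace ℝ (Fin 3)) t := by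
  have h01 : ∀ a : ZMod 2, a = 0 ∨ a = 1 := by decide
  rcases h01 a with rfl | rfl
  · simp [flip]
  · simp only [flip, if_neg (one_ne_zero : (1 : ZMod 2) ≠ 0), coe_neg_sphere, inner_neg_right]
    rw [show (1 : ZMod 2).val = 1 from rfl]
    push_cast; ring

/-- If `H₁(K)` is torsion-free and `f` is a map from the realization of `K` to the projective
plane, the double covering of the realization pulled back along `f` has an odd map to the
circle. -/
theorem exists_odd_map_of_isAddTorsionFree (hK : IsAddTorsionFree (K.Homology 1))
    (f : C(K.realization, RealProjectivePlane)) :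
    ∃ Φ : {e : K.realization × TwoSphere // f e.1 = projMap e.2} → AddCircle (2 : ℝ),
      Continuous Φ ∧ ∀ (x : K.realization) (s : TwoSphere) (h : f x = projMap s)
        (h' : f x = projMap (-s)),
        Φ ⟨(x, -s), h'⟩ = Φ ⟨(x, s), h⟩ + ((1 : ℝ) : AddCircle (2 : ℝ)) := by
  classical
  have hL : ∀ u, ∃ L : C(K.openStar u, TwoSphere), ∀ a, projMap (L a) = f ⟨a, a.2.1⟩ := fun u =>
    isCoveringMap_projMap.exists_lift_of_starConvex projMap_surjective (single_mem_openStar u)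
      (starConvex_openStar u) (f.comp ⟨fun a => ⟨a, a.2.1⟩, by fun_prop⟩)
  choose L hL using hL
  have hLL : ∀ u v x (hu : x ∈ K.openStar u) (hv : x ∈ K.openStar v),
      L u ⟨x, hu⟩ = L v ⟨x, hv⟩ ∨ L u ⟨x, hu⟩ = - L v ⟨x, hv⟩ := fun u v x hu hv =>
    projMap_eq_iff.1 ((hL u ⟨x, hu⟩).trans (hL v ⟨x, hv⟩).symm)
  have hσ : ∀ u v, ∃ σ : ZMod 2, ∀ x (hu : x ∈ K.openStar u) (hv : x ∈ K.openStar v),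
      L u ⟨x, hu⟩ = flip σ (L v ⟨x, hv⟩) := by
    intro u v
    by_cases h : ∃ x, ∃ (hu : x ∈ K.openStar u) (hv : x ∈ K.openStar v),
        L u ⟨x, hu⟩ = - L v ⟨x, hv⟩
    · obtain ⟨x₀, hu₀, hv₀, h₀⟩ := h
      refine ⟨1, fun x hu hv => ?_⟩
      have hpre : PreconnectedSpace ↥(K.openStar u ∩ K.openStar v) :=
        Subtype.preconnectedSpace (isPreconnected_openStar_inter u v)
      have := isCoveringMap_projMap.eq_of_comp_eq (A := ↥(K.openStar u ∩ K.openStar v))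
        (g₁ := fun a => L u ⟨a, a.2.1⟩) (g₂ := fun a => - L v ⟨a, a.2.2⟩) (by fun_prop)
        (by fun_prop) (by
          funext a
          simp only [Function.comp_apply, projMap_neg]
          exact (hL u ⟨a, a.2.1⟩).trans (hL v ⟨a, a.2.2⟩).symm) ⟨x₀, hu₀, hv₀⟩ h₀
      exact congr_fun this ⟨x, hu, hv⟩
    · refine ⟨0, fun x hu hv => (hLL u v x hu hv).resolve_right fun h' => h ⟨x, hu, hv, h'⟩⟩
  choose σ hσ using hσ
  -- The transition signs of the double covering are compared at a point common to the three open
  -- stars, giving a cocycle modulo 2.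
  have hσadd : ∀ u v w, (∃ s ∈ K.faces, u ∈ s ∧ v ∈ s ∧ w ∈ s) → σ u v + σ v w = σ u w := by
    rintro u v w ⟨s, hs, hu, hv, hw⟩
    obtain ⟨x, hx⟩ := exists_mem_openStar hs
    apply flip_injective (s := L w ⟨x, hx w hw⟩)
    rw [flip_add, ← hσ v w x (hx v hv) (hx w hw), ← hσ u v x (hx u hu) (hx v hv),
      ← hσ u w x (hx u hu) (hx w hw)]
  obtain ⟨ψ, hψ, hψσ⟩ := exists_int_lift hK (fun v => σ (v.1 0) (v.1 1)) (fun v => by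
    obtain ⟨s, hs, hv⟩ := v.2
    have := hσadd (v.1 0) (v.1 1) (v.1 2) ⟨s, hs, hv _, hv _, hv _⟩
    change σ (v.1 1) (v.1 2) - σ (v.1 0) (v.1 2) + σ (v.1 0) (v.1 1) = 0
    rw [← this]; abel)
  let e : ∀ u v, (∃ s ∈ K.faces, u ∈ s ∧ v ∈ s) → K.OrderedSimplex 1 := fun u v h =>
    ⟨![u, v], by
      obtain ⟨s, hs, hu, hv⟩ := h
      exact ⟨s, hs, fun i => by fin_cases i <;> assumption⟩⟩
  let c : V → V → ℤ := fun u v =>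
    if h : ∃ s ∈ K.faces, u ∈ s ∧ v ∈ s then ψ (e u v h) else 0
  have hc : ∀ u v w, (∃ s ∈ K.faces, u ∈ s ∧ v ∈ s ∧ w ∈ s) → c u v + c v w = c u w := by
    rintro u v w ⟨s, hs, hu, hv, hw⟩
    have huv : ∃ s ∈ K.faces, u ∈ s ∧ v ∈ s := ⟨s, hs, hu, hv⟩
    have hvw : ∃ s ∈ K.faces, v ∈ s ∧ w ∈ s := ⟨s, hs, hv, hw⟩
    have huw : ∃ s ∈ K.faces, u ∈ s ∧ w ∈ s := ⟨s, hs, hu, hw⟩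
    let t : K.OrderedSimplex 2 := ⟨![u, v, w], s, hs, fun i => by fin_cases i <;> assumption⟩
    have := hψ t
    simp only [c, dif_pos huv, dif_pos hvw, dif_pos huw]
    rw [show e u v huv = t.face 2 from OrderedSimplex.ext_one rfl rfl,
      show e v w hvw = t.face 0 from OrderedSimplex.ext_one rfl rfl,
      show e u w huw = t.face 1 from OrderedSimplex.ext_one rfl rfl]
    linarith
  have hcσ : ∀ u v, (∃ s ∈ K.faces, u ∈ s ∧ v ∈ s) → (c u v : ZMod 2) = σ u v := by
    intro u v h
    simp only [c, dif_pos h]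
    exact hψσ _
  let E := {e : K.realization × TwoSphere // f e.1 = projMap e.2}
  let pt : E → V → ℝ := fun e => (e.1.1 : V → ℝ)
  have hpt : Continuous pt :=
    continuous_subtype_val.comp (continuous_fst.comp continuous_subtype_val)
  have hstar : ∀ (e : E) u, pt e u ≠ 0 → pt e ∈ K.openStar u := fun e u hu => ⟨e.1.1.2, hu⟩
  -- The first term is 0 or 1 according to the sheet relative to `L u`; the second interpolates the
  -- integral cocycle in barycentric coordinates. Passing from `u` to `u'` changes the first by `± σ
  -- u u'` and the second by `c u u'`, which have the same parity, so `T` is well defined modulo 2.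
  -- The other sheet shifts it by 1.
  let T : ∀ u, {e : E // pt e u ≠ 0} → ℝ := fun u e =>
    (1 - inner ℝ (e.1.1.2 : EuclideanSpace ℝ (Fin 3)) (L u ⟨pt e.1, hstar e.1 u e.2⟩)) / 2 +
      ∑ v, pt e.1 v * c u v
  have hT : ∀ u, Continuous (T u) := by
    intro u
    have h1 : Continuous fun e : {e : E // pt e u ≠ 0} => pt e.1 :=
      hpt.comp continuous_subtype_val
    have h2 : Continuous fun e : {e : E // pt e u ≠ 0} => e.1.1.2 :=
      continuous_snd.comp (continuous_subtype_val.comp continuous_subtype_val)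
    have h3 : Continuous fun e : {e : E // pt e u ≠ 0} =>
        L u ⟨pt e.1, hstar e.1 u e.2⟩ := (L u).continuous.comp (h1.subtype_mk _)
    exact ((continuous_const.sub ((continuous_subtype_val.comp h2).inner
      (continuous_subtype_val.comp h3))).div_const 2).add
      (continuous_finsetSum _ fun v _ => ((continuous_apply v).comp h1).mul continuous_const)
  have hTT : ∀ u u' (e : E) (hu : pt e u ≠ 0) (hu' : pt e u' ≠ 0),
      (T u ⟨e, hu⟩ : AddCircle (2 : ℝ)) = T u' ⟨e, hu'⟩ := by
    intro u u' e hu hu'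
    obtain ⟨⟨hnn, hsum⟩, s, hs, hsupp⟩ := e.1.1.2
    have hface : ∃ s ∈ K.faces, u ∈ s ∧ u' ∈ s := ⟨s, hs, hsupp u hu, hsupp u' hu'⟩
    have h1 : ∑ v, pt e v * (c u v : ℝ) = c u u' + ∑ v, pt e v * (c u' v : ℝ) := by
      have : ∀ v, pt e v * (c u v : ℝ) = pt e v * c u u' + pt e v * c u' v := by
        intro v
        by_cases hv : pt e v = 0
        · simp [hv]
        · rw [← hc u u' v ⟨s, hs, hsupp u hu, hsupp u' hu', hsupp v hv⟩]
          push_cast; ring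
      rw [Finset.sum_congr rfl fun v _ => this v, Finset.sum_add_distrib, ← Finset.sum_mul]
      rw [show ∑ v, pt e v = 1 from hsum, one_mul]
    have h2 : ∃ ε : ℝ, (ε = 1 ∨ ε = -1) ∧ inner ℝ (e.1.2 : EuclideanSpace ℝ (Fin 3))
        (L u' ⟨pt e, hstar e u' hu'⟩) = ε := by
      have hx := TwoSphere.inner_self e.1.2
      have : e.1.2 = L u' ⟨pt e, hstar e u' hu'⟩ ∨ e.1.2 = - L u' ⟨pt e, hstar e u' hu'⟩ :=
        projMap_eq_iff.1 (e.2.symm.trans (hL u' ⟨pt e, hstar e u' hu'⟩).symm)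
      rcases this with h | h
      · exact ⟨1, Or.inl rfl, by rw [← h, hx]⟩
      · refine ⟨-1, Or.inr rfl, ?_⟩
        rw [← neg_eq_iff_eq_neg.2 h, coe_neg_sphere, inner_neg_right, hx]
    obtain ⟨ε, hε, hε'⟩ := h2
    simp only [T]
    rw [h1, hσ u u' (pt e) (hstar e u hu) (hstar e u' hu'), inner_flip, hε', ← hcσ u u' hface]
    obtain ⟨k, hk⟩ : ∃ k : ℤ, c u u' = ((c u u' : ZMod 2).val : ℤ) + 2 * k := by
      have : ((c u u' : ZMod 2).val : ℤ) = c u u' % 2 := ZMod.val_intCast _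
      rw [this]
      exact ⟨c u u' / 2, (Int.emod_add_mul_ediv _ _).symm⟩
    set w := ((c u u' : ZMod 2).val) with hw
    have hk' : (c u u' : ℝ) = w + 2 * k := by exact_mod_cast hk
    rw [hk', ← sub_eq_zero, ← AddCircle.coe_sub, AddCircle.coe_eq_zero_iff]
    rcases hε with rfl | rfl
    · refine ⟨w + k, ?_⟩
      rw [zsmul_eq_mul]
      push_cast
      ring
    · refine ⟨k, ?_⟩
      rw [zsmul_eq_mul]
      ring
  have hex : ∀ e : E, ∃ u, pt e u ≠ 0 := by
    intro e
    by_contra h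
    push Not at h
    have : ∑ v, pt e v = 1 := e.1.1.2.1.2
    simp [h] at this
  choose vx hvx using hex
  let Φ : E → AddCircle (2 : ℝ) := fun e => T (vx e) ⟨e, hvx e⟩
  have hΦ : ∀ e u (hu : pt e u ≠ 0), Φ e = T u ⟨e, hu⟩ := fun e u hu => hTT _ _ e (hvx e) hu
  refine ⟨Φ, ?_, fun x s h h' => ?_⟩
  · rw [continuous_iff_continuousAt]
    intro e₀
    let N : Set E := {e | pt e (vx e₀) ≠ 0}
    have hN : IsOpen N :=
      isOpen_ne_fun ((continuous_apply _).comp hpt) continuous_const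
    have : ContinuousOn Φ N := by
      rw [continuousOn_iff_continuous_domRestrict]
      have h1 : N.domRestrict Φ = fun e => ((T (vx e₀) e : ℝ) : AddCircle (2 : ℝ)) := by
        funext e
        exact hΦ e.1 _ e.2
      rw [h1]
      exact (AddCircle.continuous_mk' 2).comp (hT _)
    exact this.continuousAt (hN.mem_nhds (hvx e₀))
  · obtain ⟨u, hu⟩ : ∃ u, pt ⟨(x, s), h⟩ u ≠ 0 := ⟨_, hvx _⟩
    rw [hΦ ⟨(x, s), h⟩ u hu, hΦ ⟨(x, -s), h'⟩ u hu, ← AddCircle.coe_add, ← sub_eq_zero,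
      ← AddCircle.coe_sub, AddCircle.coe_eq_zero_iff]
    have : s = L u ⟨pt ⟨(x, s), h⟩, hstar _ u hu⟩ ∨ s = - L u ⟨pt ⟨(x, s), h⟩, hstar _ u hu⟩ :=
      projMap_eq_iff.1 (h.symm.trans (hL u ⟨pt ⟨(x, s), h⟩, hstar _ u hu⟩).symm)
    have hx := TwoSphere.inner_self s
    simp only [T]
    change ∃ n : ℤ, n • (2 : ℝ) = (1 - inner ℝ ((-s : TwoSphere) : EuclideanSpace ℝ (Fin 3))
      (L u ⟨pt ⟨(x, s), h⟩, hstar _ u hu⟩)) / 2 + ∑ v, pt ⟨(x, s), h⟩ v * c u v -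
      ((1 - inner ℝ (s : EuclideanSpace ℝ (Fin 3))
      (L u ⟨pt ⟨(x, s), h⟩, hstar _ u hu⟩)) / 2 + ∑ v, pt ⟨(x, s), h⟩ v * c u v + 1)
    rw [coe_neg_sphere, inner_neg_left]
    rcases this with h1 | h1
    · rw [← h1, hx]
      exact ⟨0, by rw [zsmul_eq_mul]; push_cast; ring⟩
    · rw [← neg_eq_iff_eq_neg.2 h1, coe_neg_sphere, inner_neg_right, hx]
      exact ⟨-1, by rw [zsmul_eq_mul]; push_cast; ring⟩

/-- A complex whose realization is homotopy equivalent to the projective plane has torsion in its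
first homology. -/
theorem not_isAddTorsionFree_of_homotopyEquiv (h : K.realization ≃ₕ RealProjectivePlane) :
    ¬ IsAddTorsionFree (K.Homology 1) := by
  intro hK
  obtain ⟨Φ, hΦ, hodd⟩ := exists_odd_map_of_isAddTorsionFree hK h.toFun
  obtain ⟨H⟩ := h.right_inv
  obtain ⟨G, hG, hGneg⟩ := exists_odd_lift H.symm
  -- The odd lift `G` of `h ∘ h⁻¹` maps the sphere equivariantly into the pulled-back covering.
  refine not_exists_odd_map ⟨fun s => Φ ⟨(h.invFun (projMap s), G s), (hG s).symm⟩, ?_⟩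
    fun s => ?_
  · refine hΦ.comp (Continuous.subtype_mk ?_ _)
    exact (h.invFun.continuous.comp continuous_projMap).prodMk G.continuous
  · have h1 : h.toFun (h.invFun (projMap s)) = projMap (- G s) := by
      rw [projMap_neg]; exact (hG s).symm
    refine Eq.trans ?_ (hodd (h.invFun (projMap s)) (G s) (hG s).symm h1)
    simp only [ContinuousMap.coe_mk, projMap_neg, hGneg]

end AbstractSimplicialComplex

/-! ### The thirteen-element poset and its moment matrices -/

/-- The faces of the hemi-octahedron: nonzero sign vectors up to sign, represented by the ones
whose first nonzero entry is positive. -/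
structure SignLine : Type u where
  /-- The normalized sign vector. -/
  val : Fin 3 → SignType
  /-- The first nonzero entry is positive. -/
  normalized : val 0 = 1 ∨ (val 0 = 0 ∧ val 1 = 1) ∨ (val 0 = 0 ∧ val 1 = 0 ∧ val 2 = 1)

namespace SignLine

/-- The entries of the rank one matrix attached to a sign vector up to sign. -/
def entry (σ : SignLine.{u}) (i j : Fin 3) : SignType := σ.val i * σ.val j

theorem entry_injective {σ τ : SignLine.{u}} (h : ∀ i j, σ.entry i j = τ.entry i j) : σ = τ := by
  obtain ⟨s, hs⟩ := σ
  obtain ⟨t, ht⟩ := τ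
  have key : s 0 = t 0 ∧ s 1 = t 1 ∧ s 2 = t 2 := by
    have h00 : s 0 * s 0 = t 0 * t 0 := h 0 0
    have h01 : s 0 * s 1 = t 0 * t 1 := h 0 1
    have h02 : s 0 * s 2 = t 0 * t 2 := h 0 2
    have h11 : s 1 * s 1 = t 1 * t 1 := h 1 1
    have h12 : s 1 * s 2 = t 1 * t 2 := h 1 2
    have h22 : s 2 * s 2 = t 2 * t 2 := h 2 2
    rcases hs with hs | hs | hs <;> rcases ht with ht | ht | ht <;> simp_all
  obtain ⟨h0, h1, h2⟩ := key
  congr 1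
  funext i
  fin_cases i <;> assumption

/-- This is inclusion of faces modulo the antipodal map: for suitable signs, `τ` agrees with `σ` on
the support of `σ`. Products of two entries do not depend on the choice of signs. -/
instance : PartialOrder SignLine.{u} where
  le σ τ := ∀ i j, σ.entry i j = 0 ∨ σ.entry i j = τ.entry i j
  le_refl σ i j := Or.inr rfl
  le_trans σ τ ρ h1 h2 i j := by
    rcases h1 i j with h | h
    · exact Or.inl h
    · rw [h]; exact h2 i j
  le_antisymm σ τ h1 h2 := entry_injective fun i j => by
    rcases h1 i j with h | h
    · rcases h2 i j with h' | h'
      · rw [h, h']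
      · exact h'.symm
    · exact h

theorem le_def {σ τ : SignLine.{u}} :
    σ ≤ τ ↔ ∀ i j, σ.entry i j = 0 ∨ σ.entry i j = τ.entry i j := Iff.rfl

/-- The type of sign vectors up to sign as a subtype. -/
def equivSubtype : SignLine.{u} ≃ {v : Fin 3 → SignType // v 0 = 1 ∨ (v 0 = 0 ∧ v 1 = 1) ∨
    (v 0 = 0 ∧ v 1 = 0 ∧ v 2 = 1)} where
  toFun σ := ⟨σ.1, σ.2⟩
  invFun v := ⟨v.1, v.2⟩
  left_inv _ := rfl
  right_inv _ := rfl

instance : Fintype SignLine.{u} := Fintype.ofEquiv _ equivSubtype.symm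

instance : DecidableEq SignLine.{u} := equivSubtype.decidableEq

/-- The count is `(3 ^ 3 - 1) / 2`. -/
theorem card_eq : Fintype.card SignLine.{u} = 13 := by
  rw [Fintype.card_congr equivSubtype]
  decide

theorem entry_ne_zero_iff {σ : SignLine.{u}} {i j : Fin 3} :
    σ.entry i j ≠ 0 ↔ σ.val i ≠ 0 ∧ σ.val j ≠ 0 := by
  unfold entry
  generalize σ.val i = a
  generalize σ.val j = b
  revert a b
  decide

theorem exists_entry_ne_zero (σ : SignLine.{u}) : ∃ i, σ.entry i i ≠ 0 := by
  simp only [entry_ne_zero_iff, and_self]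
  rcases σ.normalized with h | h | h
  · exact ⟨0, by rw [h]; decide⟩
  · exact ⟨1, by rw [h.2]; decide⟩
  · exact ⟨2, by rw [h.2.2]; decide⟩

theorem entry_eq_of_le {σ τ : SignLine.{u}} (h : σ ≤ τ) {i j : Fin 3} (h0 : σ.entry i j ≠ 0) :
    τ.entry i j = σ.entry i j :=
  ((h i j).resolve_left h0).symm

theorem exists_entry_eq (v : Fin 3 → SignType) (hv : ∃ i, v i ≠ 0) :
    ∃ σ : SignLine.{u}, ∀ i j, σ.entry i j = v i * v j := by
  have key : ∀ a b c : SignType, a ≠ 0 ∨ b ≠ 0 ∨ c ≠ 0 →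
      (a = 1 ∨ (a = 0 ∧ b = 1) ∨ (a = 0 ∧ b = 0 ∧ c = 1)) ∨
      (-a = 1 ∨ (-a = 0 ∧ -b = 1) ∨ (-a = 0 ∧ -b = 0 ∧ -c = 1)) := by decide
  have hv' : v 0 ≠ 0 ∨ v 1 ≠ 0 ∨ v 2 ≠ 0 := by
    obtain ⟨i, hi⟩ := hv
    fin_cases i
    · exact Or.inl hi
    · exact Or.inr (Or.inl hi)
    · exact Or.inr (Or.inr hi)
  rcases key _ _ _ hv' with h | h
  · exact ⟨⟨v, h⟩, fun i j => rfl⟩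
  · exact ⟨⟨fun i => - v i, h⟩, fun i j => neg_mul_neg _ _⟩

section Weights

/-- The total weight of the elements satisfying a predicate. -/
noncomputable def weight (y : SignLine.{u} → ℝ) (p : SignLine.{u} → Prop) : ℝ :=
  open Classical in ∑ σ with p σ, y σ

variable {y : SignLine.{u} → ℝ}

theorem weight_mono (hy : ∀ σ, 0 ≤ y σ) {p q : SignLine.{u} → Prop}
    (h : ∀ σ, y σ ≠ 0 → p σ → q σ) : weight y p ≤ weight y q := by
  classical
  unfold weight
  rw [Finset.sum_filter, Finset.sum_filter]
  refine Finset.sum_le_sum fun σ _ => ?_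
  by_cases h0 : y σ = 0
  · simp [h0]
  · by_cases hp : p σ
    · rw [if_pos hp, if_pos (h σ h0 hp)]
    · rw [if_neg hp]
      split_ifs
      · exact hy σ
      · exact le_rfl

theorem weight_congr {p q : SignLine.{u} → Prop} (h : ∀ σ, y σ ≠ 0 → (p σ ↔ q σ)) :
    weight y p = weight y q := by
  classical
  unfold weight
  rw [Finset.sum_filter, Finset.sum_filter]
  refine Finset.sum_congr rfl fun σ _ => ?_
  by_cases h0 : y σ = 0
  · simp [h0]
  · simp [h σ h0]

theorem weight_nonneg (hy : ∀ σ, 0 ≤ y σ) (p : SignLine.{u} → Prop) : 0 ≤ weight y p := by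
  classical
  exact Finset.sum_nonneg fun σ _ => hy σ

theorem weight_eq_zero {p : SignLine.{u} → Prop} (h : ∀ σ, y σ ≠ 0 → ¬ p σ) :
    weight y p = 0 := by
  classical
  refine Finset.sum_eq_zero fun σ hσ => ?_
  by_contra h0
  exact h σ h0 (Finset.mem_filter.1 hσ).2

/-- The matrix of a point of the realization. -/
noncomputable def moment (y : SignLine.{u} → ℝ) (i j : Fin 3) : ℝ :=
  ∑ σ, y σ * (σ.entry i j : ℝ)

theorem moment_eq_mul_weight {ε : SignType} {i j : Fin 3}
    (h : ∀ σ, y σ ≠ 0 → σ.entry i j ≠ 0 → σ.entry i j = ε) :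
    moment y i j = ε * weight y (fun σ => σ.entry i j ≠ 0) := by
  classical
  unfold moment weight
  rw [Finset.sum_filter, Finset.mul_sum]
  refine Finset.sum_congr rfl fun σ _ => ?_
  by_cases h0 : y σ = 0
  · simp [h0]
  · by_cases h1 : σ.entry i j = 0
    · simp [h1]
    · rw [if_pos h1, h σ h0 h1, mul_comm]

variable (hchain : ∀ σ τ, y σ ≠ 0 → y τ ≠ 0 → σ ≤ τ ∨ τ ≤ σ)
include hchain

/-- On a chain, the nonzero values of a given entry all have the same sign, so no cancellation
occurs in the moment. -/
theorem weight_entry_eq (hy : ∀ σ, 0 ≤ y σ) {ε : SignType} (hε : ε ≠ 0) (i j : Fin 3) :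
    weight y (fun σ => σ.entry i j = ε) = max 0 (ε * moment y i j) := by
  have hεε : (ε : ℝ) * ε = 1 := by
    revert hε; revert ε; intro ε hε
    cases ε <;> simp at hε ⊢
  by_cases h : ∃ σ, y σ ≠ 0 ∧ σ.entry i j = ε
  · obtain ⟨σ, hσ, hσε⟩ := h
    have h0 : σ.entry i j ≠ 0 := hσε ▸ hε
    have hall : ∀ τ, y τ ≠ 0 → τ.entry i j ≠ 0 → τ.entry i j = ε := by
      intro τ hτ hτ0
      rcases hchain σ τ hσ hτ with hle | hle
      · rw [entry_eq_of_le hle h0, hσε]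
      · rw [← entry_eq_of_le hle hτ0, hσε]
    rw [moment_eq_mul_weight hall, ← mul_assoc, hεε, one_mul, max_eq_right (weight_nonneg hy _)]
    exact weight_congr fun τ hτ => ⟨fun h => h ▸ hε, hall τ hτ⟩
  · push Not at h
    rw [weight_eq_zero h, max_eq_left]
    have hall : ∀ τ, y τ ≠ 0 → τ.entry i j ≠ 0 → τ.entry i j = -ε := by
      intro τ hτ hτ0
      have := h τ hτ
      clear hεε h
      generalize τ.entry i j = a at *
      revert a ε
      decide
    rw [moment_eq_mul_weight hall, ← mul_assoc, SignType.coe_neg, mul_neg, hεε]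
    have := weight_nonneg hy (fun σ => σ.entry i j ≠ 0)
    linarith

/-- Among finitely many upper sets, one is contained in all others on a chain. -/
theorem exists_weight_eq {ι : Type*} [Nonempty ι] {p : ι → SignLine.{u} → Prop}
    (hp : ∀ a σ τ, σ ≤ τ → p a σ → p a τ) :
    ∃ a, weight y (fun σ => ∀ b, p b σ) = weight y (p a) := by
  classical
  let s : Finset SignLine.{u} := Finset.univ.filter fun σ => y σ ≠ 0 ∧ ∃ a, ¬ p a σ
  rcases s.eq_empty_or_nonempty with hs | hs
  · refine ⟨Classical.arbitrary ι, weight_congr fun σ hσ => ⟨fun h => h _, fun _ b => ?_⟩⟩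
    by_contra hb
    have : σ ∈ s := Finset.mem_filter.2 ⟨Finset.mem_univ _, hσ, b, hb⟩
    simp [hs] at this
  · obtain ⟨σ, hσ⟩ := s.exists_maximal hs
    obtain ⟨-, hσ0, a, ha⟩ := Finset.mem_filter.1 hσ.1
    refine ⟨a, weight_congr fun τ hτ => ⟨fun h => h a, fun hτa b => ?_⟩⟩
    by_contra hb
    have hτs : τ ∈ s := Finset.mem_filter.2 ⟨Finset.mem_univ _, hτ, b, hb⟩
    have hτσ : τ ≤ σ := by
      rcases hchain σ τ hσ0 hτ with h | h
      · exact hσ.2 hτs h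
      · exact h
    exact ha (hp a τ σ hτσ hτa)

omit hchain

/-- Möbius inversion, by induction from the top of the poset. -/
theorem eq_of_weight_ge {y y' : SignLine.{u} → ℝ}
    (h : ∀ τ, weight y (τ ≤ ·) = weight y' (τ ≤ ·)) : y = y' := by
  classical
  funext τ
  induction τ using WellFoundedGT.induction with | _ τ ih =>
  have key : ∀ z : SignLine.{u} → ℝ, weight z (τ ≤ ·) = z τ + ∑ σ with τ < σ, z σ := by
    intro z
    unfold weight
    have : Finset.univ.filter (fun σ => τ ≤ σ) =
        insert τ (Finset.univ.filter fun σ => τ < σ) := by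
      ext σ
      simp only [Finset.mem_filter, Finset.mem_univ, true_and, Finset.mem_insert]
      rw [le_iff_eq_or_lt, eq_comm]
    rw [Finset.filter_congr_decidable, this, Finset.sum_insert (by simp)]
  have := h τ
  rw [key, key, Finset.sum_congr rfl fun σ hσ => ih σ (Finset.mem_filter.1 hσ).2] at this
  linarith

/-- Lying above `τ` is a conjunction of conditions on single entries. These define upper sets,
nested on a chain, so the weight above `τ` is the least of the weights of the single conditions, and
the moments determine those. -/
theorem moment_injective {y y' : SignLine.{u} → ℝ} (hy : ∀ σ, 0 ≤ y σ) (hy' : ∀ σ, 0 ≤ y' σ)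
    (hsum : ∑ σ, y σ = ∑ σ, y' σ)
    (hchain : ∀ σ τ, y σ ≠ 0 → y τ ≠ 0 → σ ≤ τ ∨ τ ≤ σ)
    (hchain' : ∀ σ τ, y' σ ≠ 0 → y' τ ≠ 0 → σ ≤ τ ∨ τ ≤ σ)
    (h : moment y = moment y') : y = y' := by
  classical
  apply eq_of_weight_ge
  intro τ
  let p : Fin 3 × Fin 3 → SignLine.{u} → Prop := fun a σ =>
    τ.entry a.1 a.2 = 0 ∨ τ.entry a.1 a.2 = σ.entry a.1 a.2
  have hp : ∀ a σ ρ, σ ≤ ρ → p a σ → p a ρ := by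
    rintro a σ ρ hσρ (h | h)
    · exact Or.inl h
    · by_cases h0 : τ.entry a.1 a.2 = 0
      · exact Or.inl h0
      · exact Or.inr (h.trans (entry_eq_of_le hσρ (h ▸ h0)).symm)
  have hpw : ∀ a, weight y (p a) = weight y' (p a) := by
    intro a
    by_cases h0 : τ.entry a.1 a.2 = 0
    · have : ∀ z : SignLine.{u} → ℝ, weight z (p a) = ∑ σ, z σ := fun z => by
        simp [weight, p, h0]
      rw [this, this, hsum]
    · have : ∀ z : SignLine.{u} → ℝ,
          weight z (p a) = weight z (fun σ => σ.entry a.1 a.2 = τ.entry a.1 a.2) := fun z =>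
        weight_congr fun σ _ => ⟨fun h => (h.resolve_left h0).symm, fun h => Or.inr h.symm⟩
      rw [this, this, weight_entry_eq hchain hy h0, weight_entry_eq hchain' hy' h0, h]
  have hle : ∀ z : SignLine.{u} → ℝ, weight z (τ ≤ ·) = weight z (fun σ => ∀ b, p b σ) := fun z =>
    weight_congr fun σ _ => by simp [p, le_def, Prod.forall]
  rw [hle, hle]
  obtain ⟨a, ha⟩ := exists_weight_eq hchain hp
  obtain ⟨b, hb⟩ := exists_weight_eq hchain' hp
  apply le_antisymm
  · rw [hb, ← hpw b]
    exact weight_mono hy fun σ _ h => h b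
  · rw [ha, hpw a]
    exact weight_mono hy' fun σ _ h => h a

end Weights

end SignLine

/-! ### Signed minima and the matrix of a line -/

/-- The signed minimum of the absolute values of two reals. -/
noncomputable def signedMin (a b : ℝ) : ℝ := (|a + b| - |a - b|) / 2

theorem signedMin_of_nonneg {a b : ℝ} (ha : 0 ≤ a) (hb : 0 ≤ b) : signedMin a b = min a b := by
  unfold signedMin
  rw [abs_of_nonneg (add_nonneg ha hb)]
  rcases le_total a b with h | h
  · rw [min_eq_left h, abs_of_nonpos (sub_nonpos.2 h)]; ring
  · rw [min_eq_right h, abs_of_nonneg (sub_nonneg.2 h)]; ring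

theorem signedMin_neg_left (a b : ℝ) : signedMin (-a) b = - signedMin a b := by
  unfold signedMin
  rw [show -a + b = -(a - b) by ring, show -a - b = -(a + b) by ring, abs_neg, abs_neg]
  ring

theorem signedMin_comm (a b : ℝ) : signedMin a b = signedMin b a := by
  unfold signedMin
  rw [add_comm, abs_sub_comm]

theorem signedMin_neg_right (a b : ℝ) : signedMin a (-b) = - signedMin a b := by
  rw [signedMin_comm, signedMin_neg_left, signedMin_comm]

theorem signedMin_zero_left (b : ℝ) : signedMin 0 b = 0 := by
  simp [signedMin]

theorem signedMin_zero_right (a : ℝ) : signedMin a 0 = 0 := by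
  simp [signedMin]

theorem signedMin_mul {t : ℝ} (ht : 0 ≤ t) (a b : ℝ) :
    signedMin (t * a) (t * b) = t * signedMin a b := by
  unfold signedMin
  rw [← mul_add, ← mul_sub, abs_mul, abs_mul, abs_of_nonneg ht]
  ring

theorem signedMin_self (a : ℝ) : signedMin a a = |a| := by
  unfold signedMin
  rw [sub_self, abs_zero, ← two_mul, abs_mul, abs_two]
  ring

theorem signedMin_sign (ε δ : SignType) {a b : ℝ} (ha : 0 ≤ a) (hb : 0 ≤ b) :
    signedMin (ε * a) (δ * b) = ε * δ * min a b := by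
  rw [← signedMin_of_nonneg ha hb]
  cases ε <;> cases δ <;>
    simp [signedMin_neg_left, signedMin_neg_right, signedMin_zero_left, signedMin_zero_right]

theorem eq_zero_of_signedMin_eq_zero {a b : ℝ} (h : signedMin a b = 0) : a = 0 ∨ b = 0 := by
  unfold signedMin at h
  have h1 : |a + b| = |a - b| := by linarith
  rcases abs_eq_abs.1 h1 with h2 | h2
  · right; linarith
  · left; linarith

/-- The diagonal gives equality up to sign in each coordinate. Two nonzero coordinates with
different signs would contradict the corresponding off-diagonal entry. -/
theorem eq_or_eq_neg_of_signedMin {ι : Type*} {a b : ι → ℝ}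
    (h : ∀ i j, signedMin (a i) (a j) = signedMin (b i) (b j)) : a = b ∨ a = -b := by
  have habs : ∀ i, a i = b i ∨ a i = - b i := fun i => by
    have := h i i
    rw [signedMin_self, signedMin_self] at this
    exact abs_eq_abs.1 this
  by_contra hcon
  push Not at hcon
  obtain ⟨i, hi⟩ := Function.ne_iff.1 hcon.1
  obtain ⟨j, hj⟩ := Function.ne_iff.1 hcon.2
  have hi' := (habs i).resolve_left hi
  have hj' := (habs j).resolve_right hj
  have h0 := h i j
  rw [hi', hj', signedMin_neg_left] at h0
  rcases eq_zero_of_signedMin_eq_zero (a := b i) (b := b j) (by linarith) with h | h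
  · exact hi (by rw [hi', h, neg_zero])
  · exact hj (by rw [Pi.neg_apply, hj', h, neg_zero])

/-- The matrix attached to a nonzero vector of `ℝ³` up to scaling. -/
noncomputable def lineMatrix (z : Fin 3 → ℝ) (i j : Fin 3) : ℝ := signedMin (z i) (z j) / ‖z‖

theorem lineMatrix_smul {t : ℝ} (ht : 0 < t) (z : Fin 3 → ℝ) :
    lineMatrix (t • z) = lineMatrix z := by
  funext i j
  unfold lineMatrix
  rw [Pi.smul_apply, Pi.smul_apply, smul_eq_mul, smul_eq_mul, signedMin_mul ht.le, norm_smul,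
    Real.norm_of_nonneg ht.le, mul_div_mul_left _ _ ht.ne']

theorem lineMatrix_neg (z : Fin 3 → ℝ) : lineMatrix (-z) = lineMatrix z := by
  funext i j
  unfold lineMatrix
  rw [Pi.neg_apply, Pi.neg_apply, signedMin_neg_left, signedMin_neg_right, neg_neg, norm_neg]

/-! ### The order complex and the projective plane as the same set of matrices -/

namespace SignLine

theorem mem_realization_iff {y : SignLine.{u} → ℝ} :
    y ∈ (orderComplex SignLine.{u}).realization ↔ y ∈ stdSimplex ℝ SignLine.{u} ∧
      ∀ σ τ, y σ ≠ 0 → y τ ≠ 0 → σ ≤ τ ∨ τ ≤ σ := by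
  classical
  constructor
  · rintro ⟨h, s, hs, hsy⟩
    exact ⟨h, fun σ τ hσ hτ => hs.2.total (hsy σ hσ) (hsy τ hτ)⟩
  · rintro ⟨h, hc⟩
    refine ⟨h, Finset.univ.filter (y · ≠ 0), ⟨?_, fun σ hσ τ hτ _ => ?_⟩, by simp⟩
    · by_contra hne
      rw [Finset.not_nonempty_iff_eq_empty, Finset.filter_eq_empty_iff] at hne
      have h1 : ∑ σ, y σ = 1 := h.2
      rw [Finset.sum_eq_zero fun σ hσ => not_not.1 (hne hσ)] at h1
      exact zero_ne_one h1
    · simp only [Finset.coe_filter, Set.mem_ofPred_eq, Finset.mem_univ, true_and] at hσ hτ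
      exact hc σ τ hσ hτ

/-- The signs of `z` come from the top `τ` of the supporting chain, and `|z i|` is the weight of the
vectors with nonzero `i`-th entry when `τ.val i ≠ 0`. An entry in the support of the bottom vector
has weight 1, so the sup norm is 1; nestedness of the supports turns the minimum of two such weights
into the weight of their conjunction. -/
theorem exists_lineMatrix_eq {y : SignLine.{u} → ℝ}
    (hy : y ∈ (orderComplex SignLine.{u}).realization) :
    ∃ z, z ≠ 0 ∧ lineMatrix z = moment y := by
  classical
  obtain ⟨⟨hnn, hsum⟩, hchain⟩ := mem_realization_iff.1 hy
  let s : Finset SignLine.{u} := Finset.univ.filter (y · ≠ 0)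
  have hs : s.Nonempty := by
    by_contra hne
    rw [Finset.not_nonempty_iff_eq_empty, Finset.filter_eq_empty_iff] at hne
    rw [Finset.sum_eq_zero fun σ hσ => not_not.1 (hne hσ)] at hsum
    exact zero_ne_one hsum
  have hms : ∀ σ, σ ∈ s ↔ y σ ≠ 0 := fun σ => by simp [s]
  obtain ⟨τ, hτ⟩ := s.exists_maximal hs
  have hτle : ∀ σ, y σ ≠ 0 → σ ≤ τ := fun σ hσ => by
    rcases hchain σ τ hσ ((hms τ).1 hτ.1) with h | h
    · exact h
    · exact hτ.2 ((hms σ).2 hσ) h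
  obtain ⟨ρ, hρ⟩ := s.exists_minimal hs
  have hρle : ∀ σ, y σ ≠ 0 → ρ ≤ σ := fun σ hσ => by
    rcases hchain σ ρ hσ ((hms ρ).1 hρ.1) with h | h
    · exact hρ.2 ((hms σ).2 hσ) h
    · exact h
  let r : Fin 3 → ℝ := fun i => weight y (fun σ => σ.val i ≠ 0)
  have hr : ∀ i, 0 ≤ r i := fun i => weight_nonneg hnn _
  have hr1 : ∀ i, r i ≤ 1 := fun i => by
    rw [← hsum, show ∑ σ, y σ = weight y (fun _ => True) by simp [weight]]
    exact weight_mono hnn fun _ _ _ => trivial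
  let z : Fin 3 → ℝ := fun i => (τ.val i : ℝ) * r i
  obtain ⟨i₀, hi₀⟩ := ρ.exists_entry_ne_zero
  have habs1 : ∀ {ε : SignType}, ε ≠ 0 → |(ε : ℝ)| = 1 := by
    intro ε hε
    cases ε <;> simp at hε ⊢
  have hz1 : |z i₀| = 1 := by
    have h1 : r i₀ = 1 := by
      rw [← hsum, show ∑ σ, y σ = weight y (fun _ => True) by simp [weight]]
      refine weight_congr fun σ hσ => ⟨fun _ => trivial, fun _ => ?_⟩
      have := entry_eq_of_le (hρle σ hσ) hi₀
      exact (entry_ne_zero_iff.1 (this ▸ hi₀ : σ.entry i₀ i₀ ≠ 0)).1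
    have h2 : τ.val i₀ ≠ 0 := by
      have := entry_eq_of_le (hρle τ ((hms τ).1 hτ.1)) hi₀
      exact (entry_ne_zero_iff.1 (this ▸ hi₀ : τ.entry i₀ i₀ ≠ 0)).1
    simp only [z, h1, mul_one]
    exact habs1 h2
  have hznorm : ‖z‖ = 1 := by
    apply le_antisymm
    · rw [pi_norm_le_iff_of_nonneg zero_le_one]
      intro i
      rw [Real.norm_eq_abs, abs_mul, abs_of_nonneg (hr i)]
      have : |(τ.val i : ℝ)| ≤ 1 := by cases τ.val i <;> simp
      exact mul_le_one₀ this (hr i) (hr1 i)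
    · rw [← hz1, ← Real.norm_eq_abs]
      exact norm_le_pi_norm z i₀
  refine ⟨z, fun h => by simp [h] at hznorm, ?_⟩
  funext i j
  unfold lineMatrix
  rw [hznorm, div_one, signedMin_sign _ _ (hr i) (hr j),
    moment_eq_mul_weight (ε := τ.entry i j) fun σ hσ h0 => (entry_eq_of_le (hτle σ hσ) h0).symm,
    show ((τ.entry i j : SignType) : ℝ) = τ.val i * τ.val j from map_mul SignType.castHom _ _]
  congr 1
  obtain ⟨a, ha⟩ := exists_weight_eq hchain (ι := Bool)
    (p := fun b σ => σ.val (cond b i j) ≠ 0) (by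
      intro b σ σ' hle h
      have h0 := entry_ne_zero_iff.2 ⟨h, h⟩
      have := entry_eq_of_le hle h0
      exact (entry_ne_zero_iff.1 (this ▸ h0 : σ'.entry _ _ ≠ 0)).1)
  have hw : weight y (fun σ => σ.entry i j ≠ 0) =
      weight y (fun σ => ∀ b : Bool, σ.val (cond b i j) ≠ 0) :=
    weight_congr fun σ _ => by
      rw [entry_ne_zero_iff, Bool.forall_bool, and_comm]
      rfl
  have h1 : weight y (fun σ => σ.entry i j ≠ 0) ≤ r i :=
    weight_mono hnn fun σ _ h => (entry_ne_zero_iff.1 h).1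
  have h2 : weight y (fun σ => σ.entry i j ≠ 0) ≤ r j :=
    weight_mono hnn fun σ _ h => (entry_ne_zero_iff.1 h).2
  apply le_antisymm _ (le_min h1 h2)
  rw [hw, ha]
  cases a
  · exact min_le_right _ _
  · exact min_le_left _ _

/-- Layer-cake decomposition: with the coordinates sorted by decreasing absolute value, `σ k` keeps
the signs of the `k + 1` largest and is weighted by the normalized drop to the next one. The sums
telescope to `min |z i| |z j|`. -/
theorem exists_moment_eq {z : Fin 3 → ℝ} (hz : z ≠ 0) :
    ∃ y ∈ (orderComplex SignLine.{u}).realization, moment y = lineMatrix z := by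
  classical
  obtain ⟨e, he⟩ : ∃ e : Equiv.Perm (Fin 3), ∀ k l, k ≤ l → |z (e l)| ≤ |z (e k)| :=
    ⟨Tuple.sort fun i => - |z i|, fun k l hkl => neg_le_neg_iff.1
      (Tuple.monotone_sort (fun i => - |z i|) hkl)⟩
  have h01 := he 0 1 (by decide)
  have h12 := he 1 2 (by decide)
  have hnorm : ‖z‖ = |z (e 0)| := by
    apply le_antisymm
    · rw [pi_norm_le_iff_of_nonneg (abs_nonneg _)]
      intro i
      obtain ⟨k, rfl⟩ := e.surjective i
      exact he 0 k (Fin.zero_le k)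
    · exact norm_le_pi_norm z (e 0)
  have hpos : 0 < |z (e 0)| := hnorm ▸ norm_pos_iff.2 hz
  have hσ : ∀ k : Fin 3, ∃ σ : SignLine.{u}, ∀ i j, σ.entry i j =
      (if e.symm i ≤ k then SignType.sign (z i) else 0) *
      (if e.symm j ≤ k then SignType.sign (z j) else 0) := fun k =>
    exists_entry_eq _ ⟨e 0, by
      rw [Equiv.symm_apply_apply, if_pos (Fin.zero_le k)]
      exact sign_ne_zero.2 (abs_pos.1 hpos)⟩
  choose σ hσ using hσ
  have hσmono : ∀ k l, k ≤ l → σ k ≤ σ l := by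
    intro k l hkl i j
    rw [hσ, hσ]
    by_cases hi : e.symm i ≤ k
    · by_cases hj : e.symm j ≤ k
      · right
        rw [if_pos hi, if_pos hj, if_pos (hi.trans hkl), if_pos (hj.trans hkl)]
      · left
        rw [if_neg hj, mul_zero]
    · left
      rw [if_neg hi, zero_mul]
  let c : Fin 3 → ℝ := ![|z (e 0)| - |z (e 1)|, |z (e 1)| - |z (e 2)|, |z (e 2)|]
  have hc : ∀ k, 0 ≤ c k := fun k => by
    fin_cases k
    · exact sub_nonneg.2 h01
    · exact sub_nonneg.2 h12
    · exact abs_nonneg _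
  -- Summing over `k` allows for coinciding `σ k`, which occur when some coordinates vanish.
  let y : SignLine.{u} → ℝ := fun τ => ∑ k, if σ k = τ then c k / |z (e 0)| else 0
  refine ⟨y, mem_realization_iff.2 ⟨⟨fun τ => Finset.sum_nonneg fun k _ => ?_, ?_⟩, ?_⟩, ?_⟩
  · split_ifs
    · exact div_nonneg (hc k) hpos.le
    · exact le_rfl
  · simp only [y]
    rw [Finset.sum_comm]
    simp only [Finset.sum_ite_eq, Finset.mem_univ, if_true]
    rw [← Finset.sum_div, Fin.sum_univ_three, div_eq_one_iff_eq hpos.ne']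
    change |z (e 0)| - |z (e 1)| + (|z (e 1)| - |z (e 2)|) + |z (e 2)| = |z (e 0)|
    ring
  · have hsupp : ∀ τ, y τ ≠ 0 → ∃ k, σ k = τ := by
      intro τ hτ
      by_contra h
      push Not at h
      exact hτ (Finset.sum_eq_zero fun k _ => if_neg (h k))
    intro τ τ' hτ hτ'
    obtain ⟨k, rfl⟩ := hsupp τ hτ
    obtain ⟨l, rfl⟩ := hsupp τ' hτ'
    rcases le_total k l with h | h
    · exact Or.inl (hσmono k l h)
    · exact Or.inr (hσmono l k h)
  · funext i j
    have h1 : moment y i j = ∑ k, c k / |z (e 0)| * ((σ k).entry i j : ℝ) := by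
      simp only [moment, y, Finset.sum_mul, ite_mul, zero_mul]
      rw [Finset.sum_comm]
      simp
    have h2 : signedMin (z i) (z j) =
        SignType.sign (z i) * SignType.sign (z j) * min |z i| |z j| := by
      rw [← signedMin_sign _ _ (abs_nonneg (z i)) (abs_nonneg (z j)), sign_mul_abs, sign_mul_abs]
    rw [h1, lineMatrix, hnorm, h2]
    have h3 : ∀ k, ((σ k).entry i j : ℝ) = SignType.sign (z i) * SignType.sign (z j) *
        (if e.symm i ≤ k ∧ e.symm j ≤ k then 1 else 0) := by
      intro k
      rw [hσ]
      by_cases hi : e.symm i ≤ k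
      · by_cases hj : e.symm j ≤ k
        · rw [if_pos hi, if_pos hj, if_pos ⟨hi, hj⟩, mul_one]
          exact map_mul SignType.castHom _ _
        · simp [hj]
      · simp [hi]
    have h4 : ∑ k, c k * (if e.symm i ≤ k ∧ e.symm j ≤ k then 1 else 0) = min |z i| |z j| := by
      obtain ⟨k, rfl⟩ := e.surjective i
      obtain ⟨l, rfl⟩ := e.surjective j
      simp only [Equiv.symm_apply_apply]
      have h02 := h12.trans h01
      rw [Fin.sum_univ_three]
      change (|z (e 0)| - |z (e 1)|) * _ + (|z (e 1)| - |z (e 2)|) * _ + |z (e 2)| * _ = _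
      fin_cases k <;> fin_cases l <;> simp [h01, h12, h02]
    rw [← h4, Finset.mul_sum, Finset.sum_div]
    refine Finset.sum_congr rfl fun k _ => ?_
    rw [h3]
    ring

end SignLine

/-- The embedding of the projective plane into matrices. -/
noncomputable def projMatrix : RealProjectivePlane → Fin 3 → Fin 3 → ℝ :=
  Quotient.lift (fun x : TwoSphere => lineMatrix (fun i => (x : EuclideanSpace ℝ (Fin 3)) i)) (by
    rintro x y (rfl | rfl)
    · rfl
    · exact lineMatrix_neg _)

theorem TwoSphere.coordinates_ne_zero (x : TwoSphere) :
    (fun i => (x : EuclideanSpace ℝ (Fin 3)) i) ≠ 0 := by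
  intro h
  have h1 : (x : EuclideanSpace ℝ (Fin 3)) = 0 := by
    ext i
    exact congr_fun h i
  have h2 := norm_eq_of_mem_sphere x
  rw [h1, norm_zero] at h2
  exact zero_ne_one h2

theorem continuous_projMatrix : Continuous projMatrix := by
  refine Continuous.quotient_lift (continuous_pi fun i => continuous_pi fun j => ?_) _
  have hc : Continuous fun x : TwoSphere => fun i => (x : EuclideanSpace ℝ (Fin 3)) i := by
    fun_prop
  refine Continuous.div ?_ hc.norm fun x =>
    norm_ne_zero_iff.2 (TwoSphere.coordinates_ne_zero x)
  unfold signedMin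
  fun_prop

theorem projMatrix_injective : Function.Injective projMatrix := by
  intro p q h
  obtain ⟨x, rfl⟩ := projMap_surjective p
  obtain ⟨y, rfl⟩ := projMap_surjective q
  change lineMatrix (fun i => (x : EuclideanSpace ℝ (Fin 3)) i) =
    lineMatrix (fun i => (y : EuclideanSpace ℝ (Fin 3)) i) at h
  set a := fun i => (x : EuclideanSpace ℝ (Fin 3)) i with ha
  set b := fun i => (y : EuclideanSpace ℝ (Fin 3)) i with hb
  have hapos : 0 < ‖a‖ := norm_pos_iff.2 (TwoSphere.coordinates_ne_zero x)
  have hbpos : 0 < ‖b‖ := norm_pos_iff.2 (TwoSphere.coordinates_ne_zero y)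
  have hnormed : ∀ {z : Fin 3 → ℝ}, 0 < ‖z‖ → ∀ i j,
      signedMin ((‖z‖⁻¹ • z) i) ((‖z‖⁻¹ • z) j) = lineMatrix z i j := by
    intro z hz i j
    rw [Pi.smul_apply, Pi.smul_apply, smul_eq_mul, smul_eq_mul,
      signedMin_mul (inv_nonneg.2 hz.le), lineMatrix, div_eq_inv_mul]
  -- The matrices determine the vectors, scaled to sup norm 1, up to sign; the Euclidean norm 1 then
  -- fixes the scale.
  have key := eq_or_eq_neg_of_signedMin (a := ‖a‖⁻¹ • a) (b := ‖b‖⁻¹ • b) fun i j => by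
    rw [hnormed hapos, hnormed hbpos, h]
  have hx := norm_eq_of_mem_sphere x
  have hy := norm_eq_of_mem_sphere y
  have hscale : ∀ y' : EuclideanSpace ℝ (Fin 3), ‖y'‖ = 1 →
      ‖a‖⁻¹ • (x : EuclideanSpace ℝ (Fin 3)) = ‖b‖⁻¹ • y' →
      (x : EuclideanSpace ℝ (Fin 3)) = y' := by
    intro y' hy' hxy
    have h1 := congrArg norm hxy
    rw [norm_smul, norm_smul, hx, hy', mul_one, mul_one, Real.norm_of_nonneg (inv_nonneg.2 hapos.le),
      Real.norm_of_nonneg (inv_nonneg.2 hbpos.le)] at h1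
    rw [h1] at hxy
    exact smul_right_injective _ (inv_ne_zero hbpos.ne') hxy
  rw [projMap_eq_iff]
  rcases key with key | key
  · left
    apply Subtype.ext
    refine hscale y hy ?_
    ext i
    exact congr_fun key i
  · right
    apply Subtype.ext
    rw [coe_neg_sphere]
    refine hscale _ (by rw [norm_neg, hy]) ?_
    ext i
    have := congr_fun key i
    rw [PiLp.smul_apply, PiLp.smul_apply, PiLp.neg_apply, smul_neg]
    exact this

theorem range_projMatrix :
    Set.range projMatrix = {m | ∃ z : Fin 3 → ℝ, z ≠ 0 ∧ lineMatrix z = m} := by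
  ext m
  constructor
  · rintro ⟨p, rfl⟩
    obtain ⟨x, rfl⟩ := projMap_surjective p
    exact ⟨_, TwoSphere.coordinates_ne_zero x, rfl⟩
  · rintro ⟨z, hz, rfl⟩
    let w : EuclideanSpace ℝ (Fin 3) := WithLp.toLp 2 z
    have hw : w ≠ 0 := fun h => hz (by
      funext i
      exact congrArg (fun v : EuclideanSpace ℝ (Fin 3) => v i) h)
    have hwpos : 0 < ‖w‖ := norm_pos_iff.2 hw
    refine ⟨projMap ⟨‖w‖⁻¹ • w, ?_⟩, ?_⟩
    · rw [mem_sphere_zero_iff_norm, norm_smul, norm_inv, norm_norm, inv_mul_cancel₀ hwpos.ne']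
    · exact lineMatrix_smul (inv_pos.2 hwpos) z

namespace SignLine

theorem isCompact_realization : IsCompact (orderComplex SignLine.{u}).realization := by
  have : (orderComplex SignLine.{u}).realization =
      stdSimplex ℝ SignLine.{u} ∩ ⋂ σ, ⋂ τ, {y | y σ = 0 ∨ y τ = 0 ∨ σ ≤ τ ∨ τ ≤ σ} := by
    ext y
    rw [mem_realization_iff]
    simp only [Set.mem_inter_iff, Set.mem_iInter, Set.mem_ofPred_eq]
    refine and_congr_right fun _ => forall_congr' fun σ => forall_congr' fun τ => ?_
    tauto
  rw [this]
  refine (isCompact_stdSimplex ℝ _).inter_right (isClosed_iInter fun σ => isClosed_iInter fun τ => ?_)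
  have h1 : ∀ σ : SignLine.{u}, IsClosed {y : SignLine.{u} → ℝ | y σ = 0} := fun σ =>
    isClosed_eq (continuous_apply σ) continuous_const
  exact (h1 σ).union ((h1 τ).union isClosed_const)

/-- The order complex of the face poset of the hemi-octahedron is a projective plane. -/
theorem nonempty_homeomorph :
    Nonempty ((orderComplex SignLine.{u}).realization ≃ₜ RealProjectivePlane) := by
  have : CompactSpace (orderComplex SignLine.{u}).realization :=
    isCompact_iff_compactSpace.1 isCompact_realization
  let f : (orderComplex SignLine.{u}).realization → Fin 3 → Fin 3 → ℝ := fun y => moment y.1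
  have hf : Continuous f := by
    refine continuous_pi fun i => continuous_pi fun j => continuous_finsetSum _ fun σ _ => ?_
    exact ((continuous_apply σ).comp continuous_subtype_val).mul continuous_const
  have hfinj : Function.Injective f := by
    intro y y' h
    obtain ⟨h1, h2⟩ := mem_realization_iff.1 y.2
    obtain ⟨h1', h2'⟩ := mem_realization_iff.1 y'.2
    exact Subtype.ext (moment_injective h1.1 h1'.1 (h1.2.trans h1'.2.symm) h2 h2' h)
  have hrange : Set.range f = Set.range projMatrix := by
    rw [range_projMatrix]
    ext m
    constructor
    · rintro ⟨y, rfl⟩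
      exact exists_lineMatrix_eq y.2
    · rintro ⟨z, hz, rfl⟩
      obtain ⟨y, hy, hyz⟩ := exists_moment_eq hz
      exact ⟨⟨y, hy⟩, hyz⟩
  -- Continuous injections of compact spaces into a Hausdorff space are embeddings, and here the two
  -- images coincide.
  exact ⟨((hf.isClosedEmbedding hfinj).isEmbedding.toHomeomorph.trans
    (Homeomorph.setCongr hrange)).trans
    (continuous_projMatrix.isClosedEmbedding projMatrix_injective).isEmbedding.toHomeomorph.symm⟩

end SignLine

theorem theorem2 :
    (∀ (P : Type u) [PartialOrder P] [Finite P], Nat.card P ≤ 12 →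
      IsAddTorsionFree ((orderComplex P).Homology 1)) ∧
    IsLeast {n : ℕ | ∃ (P : Type u) (_ : PartialOrder P) (_ : Fintype P), Fintype.card P = n ∧
      ¬ IsAddTorsionFree ((orderComplex P).Homology 1)} 13 ∧
    IsLeast {n : ℕ | ∃ (P : Type u) (_ : PartialOrder P) (_ : Fintype P), Fintype.card P = n ∧
      Nonempty ((orderComplex P).realization ≃ₕ RealProjectivePlane)} 13 := by
  have hsmall : ∀ (P : Type u) [PartialOrder P] [Finite P], Nat.card P ≤ 12 →
      IsAddTorsionFree ((orderComplex P).Homology 1) := fun P _ _ hP =>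
    (cocyclesLift_of_card_le hP).isAddTorsionFree
  have hequiv : Nonempty ((orderComplex SignLine.{u}).realization ≃ₕ RealProjectivePlane) :=
    SignLine.nonempty_homeomorph.map Homeomorph.toHomotopyEquiv
  refine ⟨hsmall, ⟨⟨SignLine, inferInstance, inferInstance, SignLine.card_eq, ?_⟩, ?_⟩,
    ⟨⟨SignLine, inferInstance, inferInstance, SignLine.card_eq, hequiv⟩, ?_⟩⟩
  · obtain ⟨h⟩ := hequiv
    exact AbstractSimplicialComplex.not_isAddTorsionFree_of_homotopyEquiv h
  · rintro n ⟨P, _, _, rfl, hP⟩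
    by_contra hlt
    exact hP (hsmall P (by rw [Nat.card_eq_fintype_card]; omega))
  · rintro n ⟨P, _, _, rfl, ⟨h⟩⟩
    by_contra hlt
    exact AbstractSimplicialComplex.not_isAddTorsionFree_of_homotopyEquiv h
      (hsmall P (by rw [Nat.card_eq_fintype_card]; omega))
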